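/- Let $\lambda, \rho_0, g_0$ be positive real numbers. Then there exist functions $f, \rho : [0,\infty) \to \mathbb{R}$, continuous at $0$ and twice continuously differentiable on $(0,\infty)$, that solve the reduced 't Hooft--Polyakov system $$f'' - \frac{f^2-1}{r^2}\, f = g_0^2 \rho^2 f, \qquad \rho'' + \frac{2}{r}\rho' - \frac{2 f^2}{r^2}\rho = \lambda(\rho^2-\rho_0^2)\rho \qquad (0<r<\infty),$$ satisfy the boundary conditions $$f(0)=1, \qquad \rho(0)=0, \qquad \lim_{r\to\infty} f(r) = 0, \qquad \lim_{r\to\infty}\rho(r)=\rho_0,$$ and satisfy, for every $0<r<\infty$, $$0<f(r)<1, \qquad 0<\rho(r)<\rho_0, \qquad f'(r)<0, \qquad \rho'(r)>0.$$ -/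

import Mathlib

open Set Filter Topology

/-- `(f, ρ)` is a classical (twice continuously differentiable) solution on `(0, ∞)` of the
reduced 't Hooft–Polyakov system with coupling constants `lam` and `g₀` and vacuum value `ρ₀`.
Since `(0, ∞)` is open, `deriv` is the genuine derivative at every `r > 0`; the values of `f` and
`ρ` outside `(0, ∞)` play no role here. -/
structure IsMonopoleSolution (lam ρ₀ g₀ : ℝ) (f ρ : ℝ → ℝ) : Prop where
  contDiffOn_f : ContDiffOn ℝ 2 f (Ioi 0)
  contDiffOn_ρ : ContDiffOn ℝ 2 ρ (Ioi 0)
  eq_f : ∀ r : ℝ, 0 < r →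
    deriv (deriv f) r - (f r ^ 2 - 1) / r ^ 2 * f r = g₀ ^ 2 * ρ r ^ 2 * f r
  eq_ρ : ∀ r : ℝ, 0 < r →
    deriv (deriv ρ) r + 2 / r * deriv ρ r - 2 * f r ^ 2 / r ^ 2 * ρ r =
      lam * (ρ r ^ 2 - ρ₀ ^ 2) * ρ r

/-- The boundary conditions `f(0) = 1`, `ρ(0) = 0`, `f(∞) = 0`, `ρ(∞) = ρ₀`. The values at `0`
are attained continuously from the right, those at `∞` are limits. -/
structure MonopoleBoundaryConditions (ρ₀ : ℝ) (f ρ : ℝ → ℝ) : Prop where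
  f_zero : f 0 = 1
  continuous_f_zero : ContinuousWithinAt f (Ici 0) 0
  ρ_zero : ρ 0 = 0
  continuous_ρ_zero : ContinuousWithinAt ρ (Ici 0) 0
  f_infty : Tendsto f atTop (𝓝 0)
  ρ_infty : Tendsto ρ atTop (𝓝 ρ₀)

/-! With `w = r ρ` both equations take the form `-u'' + (2/r² + μ²) u = source`. For `μ² = g₀² ρ₀² +
2 lam ρ₀²` and `0 ≤ f ≤ 1`, `0 ≤ w ≤ ρ₀ r`, the sources are monotone for the order in which `f`
increases and `w` decreases (`srcF_mono`, `srcW_anti`). The operator has an explicit positive Green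
function and a maximum principle (`nonneg_of_deriv_le`). Monotone iteration from the lower pair
`(exp (-g₀ ρ₀ r), ρ₀ r)` therefore converges to a solution lying below every upper pair that
dominates the start (`exists_minimal_solution`).

Minimality is then used twice. Comparison with an explicit barrier (`isUpperPair_barrier`) keeps `ρ`
away from zero and forces `ρ → ρ₀` at infinity. Comparison with the solution's own dilations `(f (s
r), w (s r) / s)`, `0 < s < 1`, which are upper pairs (`isUpperPair_scaled`), shows that `f`
decreases and `ρ` increases. Monotonicity gives the other limits: `f → 0` since otherwise `f` would
become uniformly convex, and `ρ → 0` at the origin since otherwise `ρ` would diverge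
logarithmically. The strict inequalities follow from second-derivative tests at a hypothetical point
of equality. -/

namespace Monopole

open MeasureTheory

/-! ### Fundamental solutions of the linear operator. -/

/-- The potential of the linear operator `u ↦ -u'' + pot μ u`. -/
noncomputable def pot (μ r : ℝ) : ℝ := 2 / r ^ 2 + μ ^ 2

/-- The solution of `y'' = pot μ y` that vanishes at `0`. -/
noncomputable def regSol (μ r : ℝ) : ℝ := μ * Real.cosh (μ * r) - Real.sinh (μ * r) / r

noncomputable def regSolDeriv (μ r : ℝ) : ℝ := μ ^ 2 * Real.sinh (μ * r) - regSol μ r / r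

/-- The solution of `y'' = pot μ y` that decays at infinity. -/
noncomputable def decSol (μ r : ℝ) : ℝ := Real.exp (-(μ * r)) * (μ + 1 / r)

noncomputable def decSolDeriv (μ r : ℝ) : ℝ :=
  -(μ * decSol μ r) - Real.exp (-(μ * r)) / r ^ 2

variable {μ r : ℝ}

lemma pot_pos (hr : 0 < r) : 0 < pot μ r := by unfold pot; positivity

lemma hasDerivAt_regSol (hr : 0 < r) : HasDerivAt (regSol μ) (regSolDeriv μ r) r := by
  have h0 : HasDerivAt (fun r : ℝ => μ * r) μ r := by simpa using (hasDerivAt_id r).const_mul μ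
  have h := (h0.cosh.const_mul μ).sub (h0.sinh.div (hasDerivAt_id r) hr.ne')
  refine h.congr_deriv ?_
  simp only [regSolDeriv, regSol, id]
  field_simp

lemma hasDerivAt_regSolDeriv (hr : 0 < r) :
    HasDerivAt (regSolDeriv μ) (pot μ r * regSol μ r) r := by
  have h0 : HasDerivAt (fun r : ℝ => μ * r) μ r := by simpa using (hasDerivAt_id r).const_mul μ
  have h := (h0.sinh.const_mul (μ ^ 2)).sub
    ((hasDerivAt_regSol (μ := μ) hr).div (hasDerivAt_id r) hr.ne')
  refine h.congr_deriv ?_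
  simp only [regSolDeriv, regSol, id, pot]
  field_simp
  ring

lemma hasDerivAt_exp_neg_mul : HasDerivAt (fun r : ℝ => Real.exp (-(μ * r)))
    (-(μ * Real.exp (-(μ * r)))) r := by
  have h0 : HasDerivAt (fun r : ℝ => -(μ * r)) (-μ) r := by
    simpa using ((hasDerivAt_id r).const_mul μ).fun_neg
  exact h0.exp.congr_deriv (by ring)

lemma hasDerivAt_decSol (hr : 0 < r) : HasDerivAt (decSol μ) (decSolDeriv μ r) r := by
  have h := (hasDerivAt_exp_neg_mul (μ := μ) (r := r)).mul
    (((hasDerivAt_const r (1 : ℝ)).div (hasDerivAt_id r) hr.ne').const_add μ)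
  refine h.congr_deriv ?_
  simp only [decSolDeriv, decSol, id, Pi.div_apply]
  field_simp
  ring

lemma hasDerivAt_decSolDeriv (hr : 0 < r) :
    HasDerivAt (decSolDeriv μ) (pot μ r * decSol μ r) r := by
  have h := (((hasDerivAt_decSol (μ := μ) hr).const_mul μ).neg).sub
    ((hasDerivAt_exp_neg_mul (μ := μ) (r := r)).div ((hasDerivAt_id r).pow 2)
      (pow_ne_zero 2 hr.ne'))
  refine h.congr_deriv ?_
  simp only [decSolDeriv, decSol, id, pot, Pi.pow_apply]
  field_simp
  ring

/-- The equation has no first-order term, so the Wronskian is constant; its value normalises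
`green`. -/
lemma wronskian_eq (hr : 0 < r) :
    regSolDeriv μ r * decSol μ r - regSol μ r * decSolDeriv μ r = μ ^ 3 := by
  have h1 : Real.exp (μ * r) * Real.exp (-(μ * r)) = 1 := by rw [← Real.exp_add]; simp
  simp only [regSolDeriv, regSol, decSolDeriv, decSol, Real.cosh_eq, Real.sinh_eq]
  generalize Real.exp (μ * r) = a at *
  generalize Real.exp (-(μ * r)) = b at *
  field_simp
  linear_combination (2 * μ ^ 3 * r ^ 3) * h1

lemma sinh_le_mul_cosh {x : ℝ} (hx : 0 ≤ x) : Real.sinh x ≤ x * Real.cosh x := by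
  have h : MonotoneOn (fun x : ℝ => x * Real.cosh x - Real.sinh x) (Ici 0) := by
    refine monotoneOn_of_deriv_nonneg (convex_Ici 0) (by fun_prop) (by fun_prop) fun x hx => ?_
    rw [interior_Ici, mem_Ioi] at hx
    have : HasDerivAt (fun x : ℝ => x * Real.cosh x - Real.sinh x)
        (1 * Real.cosh x + x * Real.sinh x - Real.cosh x) x :=
      ((hasDerivAt_id x).mul (Real.hasDerivAt_cosh x)).sub (Real.hasDerivAt_sinh x)
    rw [this.deriv]
    have := mul_pos hx (Real.sinh_pos_iff.2 hx)
    linarith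
  have := h self_mem_Ici hx hx
  simp at this
  exact this

lemma cosh_sub_one_le {x : ℝ} (hx : 0 ≤ x) : Real.cosh x - 1 ≤ x * Real.sinh x := by
  have h : MonotoneOn (fun x : ℝ => x * Real.sinh x - Real.cosh x) (Ici 0) := by
    refine monotoneOn_of_deriv_nonneg (convex_Ici 0) (by fun_prop) (by fun_prop) fun x hx => ?_
    rw [interior_Ici, mem_Ioi] at hx
    have : HasDerivAt (fun x : ℝ => x * Real.sinh x - Real.cosh x)
        (1 * Real.sinh x + x * Real.cosh x - Real.sinh x) x :=
      ((hasDerivAt_id x).mul (Real.hasDerivAt_sinh x)).sub (Real.hasDerivAt_cosh x)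
    rw [this.deriv]
    have := mul_pos hx (Real.cosh_pos x)
    linarith
  have := h self_mem_Ici hx hx
  simp at this
  linarith

lemma regSol_nonneg (hμ : 0 < μ) (hr : 0 < r) : 0 ≤ regSol μ r := by
  have h := sinh_le_mul_cosh (mul_pos hμ hr).le
  rw [regSol, sub_nonneg, div_le_iff₀ hr]
  linarith

/-- Vanishing to second order at `0` offsets the `2 / r ^ 2` in `pot` and makes the product
integrable there. -/
lemma regSol_le (hμ : 0 < μ) (hr : 0 < r) :
    regSol μ r ≤ μ ^ 3 * r ^ 2 * Real.cosh (μ * r) := by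
  have hx := mul_pos hμ hr
  have h1 := sinh_le_mul_cosh hx.le
  have h2 := cosh_sub_one_le hx.le
  have h3 := Real.self_le_sinh_iff.2 hx.le
  have h4 : μ ≤ Real.sinh (μ * r) / r := by rwa [le_div_iff₀ hr]
  have h5 := mul_le_mul_of_nonneg_left h1 hx.le
  have h6 : μ * (Real.cosh (μ * r) - 1) ≤ μ * (μ * r * (μ * r * Real.cosh (μ * r))) :=
    mul_le_mul_of_nonneg_left (h2.trans h5) hμ.le
  unfold regSol
  linarith

lemma decSol_pos (hμ : 0 < μ) (hr : 0 < r) : 0 < decSol μ r := by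
  unfold decSol; positivity

lemma continuousOn_regSol : ContinuousOn (regSol μ) (Ioi 0) :=
  fun _ hx => (hasDerivAt_regSol hx).continuousAt.continuousWithinAt

lemma continuousOn_decSol : ContinuousOn (decSol μ) (Ioi 0) :=
  fun _ hx => (hasDerivAt_decSol hx).continuousAt.continuousWithinAt

/-! ### Admissible sources and their integrability against the fundamental solutions. -/

/-- A nonnegative measurable source dominated by `C (1 + r) pot μ r`. -/
structure IsSource (μ C : ℝ) (h : ℝ → ℝ) : Prop where
  aesm : AEStronglyMeasurable h (volume.restrict (Ioi 0))
  nonneg : ∀ r, 0 < r → 0 ≤ h r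
  le : ∀ r, 0 < r → h r ≤ C * ((1 + r) * pot μ r)

lemma continuousOn_pot : ContinuousOn (pot μ) (Ioi 0) := by
  unfold pot
  refine (continuousOn_const.div (by fun_prop) fun x hx => ?_).add continuousOn_const
  exact pow_ne_zero 2 (ne_of_gt hx)

lemma continuousOn_maxSource : ContinuousOn (fun r => (1 + r) * pot μ r) (Ioi 0) :=
  ContinuousOn.mul (by fun_prop) continuousOn_pot

lemma isSource_max : IsSource μ 1 fun r => (1 + r) * pot μ r where
  aesm := continuousOn_maxSource.aestronglyMeasurable measurableSet_Ioi
  nonneg r hr := mul_nonneg (by positivity) (pot_pos hr).le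
  le r hr := by simp

/-- Lagrange's identity: since `1 + r` has zero second derivative and `y'' = pot μ y`, the product
`y (1 + r) pot μ` is an exact derivative. This is why `(1 + r) pot μ` serves as the majorant. -/
lemma hasDerivAt_regSol_primitive (hr : 0 < r) :
    HasDerivAt (fun r => (1 + r) * regSolDeriv μ r - regSol μ r)
      (regSol μ r * ((1 + r) * pot μ r)) r := by
  have h := (((hasDerivAt_id r).const_add 1).mul (hasDerivAt_regSolDeriv (μ := μ) hr)).sub
    (hasDerivAt_regSol (μ := μ) hr)
  refine h.congr_deriv ?_
  simp only [id]
  ring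

lemma hasDerivAt_decSol_primitive (hr : 0 < r) :
    HasDerivAt (fun r => (1 + r) * decSolDeriv μ r - decSol μ r)
      (decSol μ r * ((1 + r) * pot μ r)) r := by
  have h := (((hasDerivAt_id r).const_add 1).mul (hasDerivAt_decSolDeriv (μ := μ) hr)).sub
    (hasDerivAt_decSol (μ := μ) hr)
  refine h.congr_deriv ?_
  simp only [id]
  ring

lemma tendsto_regSol_zero (hμ : 0 < μ) : Tendsto (regSol μ) (𝓝[>] 0) (𝓝 0) := by
  have h : Tendsto (fun r => μ ^ 3 * r ^ 2 * Real.cosh (μ * r)) (𝓝[>] 0) (𝓝 0) := by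
    have : Continuous fun r => μ ^ 3 * r ^ 2 * Real.cosh (μ * r) := by fun_prop
    simpa using (this.tendsto 0).mono_left nhdsWithin_le_nhds
  refine tendsto_of_tendsto_of_tendsto_of_le_of_le' tendsto_const_nhds h ?_ ?_ <;>
    filter_upwards [self_mem_nhdsWithin] with r hr
  exacts [regSol_nonneg hμ hr, regSol_le hμ hr]

lemma tendsto_regSol_div_zero (hμ : 0 < μ) :
    Tendsto (fun r => regSol μ r / r) (𝓝[>] 0) (𝓝 0) := by
  have h : Tendsto (fun r => μ ^ 3 * r * Real.cosh (μ * r)) (𝓝[>] 0) (𝓝 0) := by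
    have : Continuous fun r => μ ^ 3 * r * Real.cosh (μ * r) := by fun_prop
    simpa using (this.tendsto 0).mono_left nhdsWithin_le_nhds
  refine tendsto_of_tendsto_of_tendsto_of_le_of_le' tendsto_const_nhds h ?_ ?_ <;>
    filter_upwards [self_mem_nhdsWithin] with r hr
  · exact div_nonneg (regSol_nonneg hμ hr) (le_of_lt hr)
  · rw [div_le_iff₀ hr]
    linarith [regSol_le hμ hr]

lemma tendsto_regSol_primitive (hμ : 0 < μ) :
    Tendsto (fun r => (1 + r) * regSolDeriv μ r - regSol μ r) (𝓝[>] 0) (𝓝 0) := by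
  have h1 : Tendsto (fun r => 1 + r) (𝓝[>] (0 : ℝ)) (𝓝 1) := by
    have : Continuous fun r : ℝ => 1 + r := by fun_prop
    simpa using (this.tendsto 0).mono_left nhdsWithin_le_nhds
  have h2 : Tendsto (fun r => μ ^ 2 * Real.sinh (μ * r)) (𝓝[>] (0 : ℝ)) (𝓝 0) := by
    have : Continuous fun r => μ ^ 2 * Real.sinh (μ * r) := by fun_prop
    simpa using (this.tendsto 0).mono_left nhdsWithin_le_nhds
  have h3 := (h1.mul (h2.sub (tendsto_regSol_div_zero hμ))).sub (tendsto_regSol_zero hμ)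
  simpa [regSolDeriv] using h3

lemma tendsto_decSol_primitive (hμ : 0 < μ) :
    Tendsto (fun r => (1 + r) * decSolDeriv μ r - decSol μ r) atTop (𝓝 0) := by
  have hlin : Tendsto (fun r : ℝ => μ * r) atTop atTop := tendsto_id.const_mul_atTop hμ
  have e0 : Tendsto (fun r : ℝ => Real.exp (-(μ * r))) atTop (𝓝 0) :=
    Real.tendsto_exp_neg_atTop_nhds_zero.comp hlin
  have e1 : Tendsto (fun r : ℝ => r * Real.exp (-(μ * r))) atTop (𝓝 0) := by
    have := ((Real.tendsto_pow_mul_exp_neg_atTop_nhds_zero 1).comp hlin).const_mul (1 / μ)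
    rw [mul_zero] at this
    refine this.congr fun r => ?_
    simp only [Function.comp, pow_one]
    field_simp
  have i1 : Tendsto (fun r : ℝ => r⁻¹) atTop (𝓝 0) := tendsto_inv_atTop_zero
  -- The primitive is minus `exp (-μ r)` times `μ² r + (μ² + 2 μ) + (μ + 2) / r + 1 / r²`.
  have h := ((((e1.const_mul (μ ^ 2)).add (e0.const_mul (μ ^ 2 + 2 * μ))).add
    ((e0.mul i1).const_mul (μ + 2))).add ((e0.mul (i1.mul i1)))).neg
  simp only [mul_zero, add_zero, neg_zero] at h
  refine h.congr' ?_
  filter_upwards [eventually_gt_atTop 0] with r hr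
  simp only [decSolDeriv, decSol]
  field_simp
  ring

lemma integrableOn_decSol_mul_max (hμ : 0 < μ) (hr : 0 < r) :
    IntegrableOn (fun s => decSol μ s * ((1 + s) * pot μ s)) (Ioi r) :=
  integrableOn_Ioi_deriv_of_nonneg'
    (fun _ hx => hasDerivAt_decSol_primitive (hr.trans_le hx))
    (fun x hx => mul_nonneg (decSol_pos hμ (hr.trans hx)).le
      (isSource_max.nonneg x (hr.trans hx))) (tendsto_decSol_primitive hμ)

lemma integral_decSol_mul_max (hμ : 0 < μ) (hr : 0 < r) :
    ∫ s in Ioi r, decSol μ s * ((1 + s) * pot μ s) =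
      decSol μ r - (1 + r) * decSolDeriv μ r := by
  rw [integral_Ioi_of_hasDerivAt_of_tendsto'
    (fun _ hx => hasDerivAt_decSol_primitive (hr.trans_le hx))
    (integrableOn_decSol_mul_max hμ hr) (tendsto_decSol_primitive hμ)]
  ring

lemma integrableOn_regSol_mul_max (hμ : 0 < μ) :
    IntegrableOn (fun s => regSol μ s * ((1 + s) * pot μ s)) (Ioc 0 r) := by
  have hb : IntegrableOn (fun s => μ ^ 3 * Real.cosh (μ * s) * (1 + s) * (2 + μ ^ 2 * s ^ 2))
      (Ioc 0 r) := Continuous.integrableOn_Ioc (by fun_prop)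
  refine hb.mono' ?_ ?_
  · exact ((continuousOn_regSol.mul continuousOn_maxSource).mono
      Ioc_subset_Ioi_self).aestronglyMeasurable measurableSet_Ioc
  · refine (ae_restrict_iff' measurableSet_Ioc).2 (ae_of_all _ fun s hs => ?_)
    have h0 := regSol_nonneg hμ hs.1
    have hn := isSource_max.nonneg (μ := μ) s hs.1
    rw [Real.norm_of_nonneg (mul_nonneg h0 hn)]
    refine (mul_le_mul_of_nonneg_right (regSol_le hμ hs.1) hn).trans (le_of_eq ?_)
    have := hs.1.ne'
    unfold pot
    field_simp

lemma integral_regSol_mul_max (hμ : 0 < μ) (hr : 0 < r) :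
    ∫ s in Ioc 0 r, regSol μ s * ((1 + s) * pot μ s) =
      (1 + r) * regSolDeriv μ r - regSol μ r := by
  rw [← intervalIntegral.integral_of_le hr.le,
    intervalIntegral.integral_eq_sub_of_hasDerivAt_of_tendsto hr
    (fun x hx => hasDerivAt_regSol_primitive hx.1) ?_ (tendsto_regSol_primitive hμ)
    ((hasDerivAt_regSol_primitive hr).continuousAt.tendsto.mono_left nhdsWithin_le_nhds), sub_zero]
  rw [intervalIntegrable_iff_integrableOn_Ioc_of_le hr.le]
  exact integrableOn_regSol_mul_max hμ

namespace IsSource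

variable {C : ℝ} {h : ℝ → ℝ}

lemma integrableOn_decSol (hh : IsSource μ C h) (hμ : 0 < μ) (hr : 0 < r) :
    IntegrableOn (fun s => decSol μ s * h s) (Ioi r) := by
  refine ((integrableOn_decSol_mul_max hμ hr).const_mul C).mono' ?_ ?_
  · exact ((continuousOn_decSol.mono (Ioi_subset_Ioi hr.le)).aestronglyMeasurable
      measurableSet_Ioi).mul (hh.aesm.mono_set (Ioi_subset_Ioi hr.le))
  · refine (ae_restrict_iff' measurableSet_Ioi).2 (ae_of_all _ fun s hs => ?_)
    have hs0 := hr.trans hs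
    have h0 := (decSol_pos hμ hs0).le
    rw [Real.norm_of_nonneg (mul_nonneg h0 (hh.nonneg s hs0))]
    linarith [mul_le_mul_of_nonneg_left (hh.le s hs0) h0]

lemma integrableOn_regSol (hh : IsSource μ C h) (hμ : 0 < μ) :
    IntegrableOn (fun s => regSol μ s * h s) (Ioc 0 r) := by
  refine ((integrableOn_regSol_mul_max hμ).const_mul C).mono' ?_ ?_
  · exact ((continuousOn_regSol.mono Ioc_subset_Ioi_self).aestronglyMeasurable
      measurableSet_Ioc).mul (hh.aesm.mono_set Ioc_subset_Ioi_self)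
  · refine (ae_restrict_iff' measurableSet_Ioc).2 (ae_of_all _ fun s hs => ?_)
    have h0 := regSol_nonneg hμ hs.1
    rw [Real.norm_of_nonneg (mul_nonneg h0 (hh.nonneg s hs.1))]
    linarith [mul_le_mul_of_nonneg_left (hh.le s hs.1) h0]

end IsSource

end Monopole

/-! ### The Green operator: positivity, bounds, regularity, limits. -/

namespace Monopole

open MeasureTheory

variable {μ r C : ℝ} {h : ℝ → ℝ}

/-- The Green operator of `u ↦ -u'' + pot μ u` on the half-line. -/
noncomputable def green (μ : ℝ) (h : ℝ → ℝ) (r : ℝ) : ℝ :=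
  (μ ^ 3)⁻¹ * (regSol μ r * (∫ s in Ioi r, decSol μ s * h s) +
    decSol μ r * ∫ s in Ioc 0 r, regSol μ s * h s)

noncomputable def greenDeriv (μ : ℝ) (h : ℝ → ℝ) (r : ℝ) : ℝ :=
  (μ ^ 3)⁻¹ * (regSolDeriv μ r * (∫ s in Ioi r, decSol μ s * h s) +
    decSolDeriv μ r * ∫ s in Ioc 0 r, regSol μ s * h s)

lemma green_nonneg (hh : IsSource μ C h) (hμ : 0 < μ) (hr : 0 < r) : 0 ≤ green μ h r := by
  have h1 : 0 ≤ ∫ s in Ioi r, decSol μ s * h s :=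
    setIntegral_nonneg measurableSet_Ioi fun s hs =>
      mul_nonneg (decSol_pos hμ (hr.trans hs)).le (hh.nonneg s (hr.trans hs))
  have h2 : 0 ≤ ∫ s in Ioc 0 r, regSol μ s * h s :=
    setIntegral_nonneg measurableSet_Ioc fun s hs =>
      mul_nonneg (regSol_nonneg hμ hs.1) (hh.nonneg s hs.1)
  have h3 := regSol_nonneg hμ hr
  have h4 := (decSol_pos hμ hr).le
  unfold green
  positivity

lemma green_mono {h₁ h₂ : ℝ → ℝ} {C₁ C₂ : ℝ} (hh₁ : IsSource μ C₁ h₁) (hh₂ : IsSource μ C₂ h₂)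
    (hμ : 0 < μ) (hle : ∀ s, 0 < s → h₁ s ≤ h₂ s) (hr : 0 < r) :
    green μ h₁ r ≤ green μ h₂ r := by
  have h1 : ∫ s in Ioi r, decSol μ s * h₁ s ≤ ∫ s in Ioi r, decSol μ s * h₂ s :=
    setIntegral_mono_on (hh₁.integrableOn_decSol hμ hr) (hh₂.integrableOn_decSol hμ hr)
      measurableSet_Ioi fun s hs =>
        mul_le_mul_of_nonneg_left (hle s (hr.trans hs)) (decSol_pos hμ (hr.trans hs)).le
  have h2 : ∫ s in Ioc 0 r, regSol μ s * h₁ s ≤ ∫ s in Ioc 0 r, regSol μ s * h₂ s :=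
    setIntegral_mono_on (hh₁.integrableOn_regSol hμ) (hh₂.integrableOn_regSol hμ)
      measurableSet_Ioc fun s hs => mul_le_mul_of_nonneg_left (hle s hs.1) (regSol_nonneg hμ hs.1)
  have h3 := regSol_nonneg hμ hr
  have h4 := (decSol_pos hμ hr).le
  unfold green
  gcongr

/-- The majorant `(1 + r) pot μ` is mapped to `1 + r` exactly: in the two explicit integrals
everything but the Wronskian cancels. -/
lemma green_le (hh : IsSource μ C h) (hμ : 0 < μ) (hr : 0 < r) :
    green μ h r ≤ C * (1 + r) := by
  have h1 : ∫ s in Ioi r, decSol μ s * h s ≤ C * (decSol μ r - (1 + r) * decSolDeriv μ r) := by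
    rw [← integral_decSol_mul_max hμ hr, ← integral_const_mul]
    refine setIntegral_mono_on (hh.integrableOn_decSol hμ hr)
      ((integrableOn_decSol_mul_max hμ hr).const_mul C) measurableSet_Ioi fun s hs => ?_
    linarith [mul_le_mul_of_nonneg_left (hh.le s (hr.trans hs)) (decSol_pos hμ (hr.trans hs)).le]
  have h2 : ∫ s in Ioc 0 r, regSol μ s * h s ≤ C * ((1 + r) * regSolDeriv μ r - regSol μ r) := by
    rw [← integral_regSol_mul_max hμ hr, ← integral_const_mul]
    refine setIntegral_mono_on (hh.integrableOn_regSol hμ)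
      ((integrableOn_regSol_mul_max hμ).const_mul C) measurableSet_Ioc fun s hs => ?_
    linarith [mul_le_mul_of_nonneg_left (hh.le s hs.1) (regSol_nonneg hμ hs.1)]
  have h3 := mul_le_mul_of_nonneg_left h1 (regSol_nonneg hμ hr)
  have h4 := mul_le_mul_of_nonneg_left h2 (decSol_pos hμ hr).le
  unfold green
  rw [inv_mul_le_iff₀ (by positivity)]
  calc _ ≤ _ := add_le_add h3 h4
    _ = (regSolDeriv μ r * decSol μ r - regSol μ r * decSolDeriv μ r) * (C * (1 + r)) := by ring
    _ = _ := by rw [wronskian_eq hr]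

lemma IsSource.intervalIntegrable_decSol (hh : IsSource μ C h) (hμ : 0 < μ) {a b : ℝ}
    (ha : 0 < a) (hb : 0 < b) : IntervalIntegrable (fun s => decSol μ s * h s) volume a b := by
  rw [intervalIntegrable_iff]
  exact (hh.integrableOn_decSol hμ (lt_min ha hb)).mono_set Ioc_subset_Ioi_self

lemma IsSource.intervalIntegrable_regSol (hh : IsSource μ C h) (hμ : 0 < μ) {b : ℝ}
    (hb : 0 ≤ b) : IntervalIntegrable (fun s => regSol μ s * h s) volume 0 b := by
  rw [intervalIntegrable_iff_integrableOn_Ioc_of_le hb]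
  exact hh.integrableOn_regSol hμ

lemma eventually_integral_Ioi_eq (hh : IsSource μ C h) (hμ : 0 < μ) (hr : 0 < r) :
    (fun x => ∫ s in Ioi x, decSol μ s * h s) =ᶠ[𝓝 r] fun x =>
      (∫ s in Ioi r, decSol μ s * h s) - ∫ s in r..x, decSol μ s * h s := by
  filter_upwards [Ioi_mem_nhds hr] with x hx
  rw [← intervalIntegral.integral_interval_add_Ioi (hh.integrableOn_decSol hμ hr)
    (hh.integrableOn_decSol hμ hx)]
  ring

lemma eventually_integral_Ioc_eq (hr : 0 < r) :
    (fun x => ∫ s in Ioc 0 x, regSol μ s * h s) =ᶠ[𝓝 r] fun x =>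
      ∫ s in (0 : ℝ)..x, regSol μ s * h s := by
  filter_upwards [Ioi_mem_nhds hr] with x hx
  rw [intervalIntegral.integral_of_le (le_of_lt hx)]

lemma continuousAt_integral_Ioi (hh : IsSource μ C h) (hμ : 0 < μ) (hr : 0 < r) :
    ContinuousAt (fun x => ∫ s in Ioi x, decSol μ s * h s) r := by
  refine ContinuousAt.congr ?_ (eventually_integral_Ioi_eq hh hμ hr).symm
  have hI := hh.intervalIntegrable_decSol hμ (half_pos hr) (by positivity : 0 < r + 1)
  have hc := intervalIntegral.continuousOn_primitive_interval' hI
    (a := r) (by rw [uIcc_of_le (by linarith)]; constructor <;> linarith)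
  rw [uIcc_of_le (by linarith)] at hc
  exact continuousAt_const.sub (hc.continuousAt (Icc_mem_nhds (by linarith) (by linarith)))

lemma continuousAt_integral_Ioc (hh : IsSource μ C h) (hμ : 0 < μ) (hr : 0 < r) :
    ContinuousAt (fun x => ∫ s in Ioc 0 x, regSol μ s * h s) r := by
  refine ContinuousAt.congr ?_ (eventually_integral_Ioc_eq hr).symm
  have hI := hh.intervalIntegrable_regSol hμ (by positivity : 0 ≤ r + 1)
  have hc := intervalIntegral.continuousOn_primitive_interval' hI (a := 0) left_mem_uIcc
  rw [uIcc_of_le (by linarith)] at hc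
  exact hc.continuousAt (Icc_mem_nhds hr (by linarith))

/-- Continuity of `h` is not assumed: the limit of the iterates is at first only measurable, and its
fixed-point equation makes it continuous through this lemma. -/
lemma continuousOn_green (hh : IsSource μ C h) (hμ : 0 < μ) :
    ContinuousOn (green μ h) (Ioi 0) := fun r hr => by
  refine ContinuousAt.continuousWithinAt ?_
  exact continuousAt_const.mul
    (((hasDerivAt_regSol hr).continuousAt.mul (continuousAt_integral_Ioi hh hμ hr)).add
    ((hasDerivAt_decSol hr).continuousAt.mul (continuousAt_integral_Ioc hh hμ hr)))

lemma IsSource.stronglyMeasurableAtFilter (hh : IsSource μ C h) {y : ℝ → ℝ}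
    (hy : ContinuousOn y (Ioi 0)) (hr : 0 < r) :
    StronglyMeasurableAtFilter (fun s => y s * h s) (𝓝 r) volume :=
  ⟨Ioi 0, Ioi_mem_nhds hr, (hy.aestronglyMeasurable measurableSet_Ioi).mul hh.aesm⟩

lemma hasDerivAt_integral_Ioi (hh : IsSource μ C h) (hμ : 0 < μ) (hr : 0 < r)
    (hc : ContinuousAt h r) :
    HasDerivAt (fun x => ∫ s in Ioi x, decSol μ s * h s) (-(decSol μ r * h r)) r := by
  refine HasDerivAt.congr_of_eventuallyEq ?_ (eventually_integral_Ioi_eq hh hμ hr)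
  simpa using (hasDerivAt_const r (∫ s in Ioi r, decSol μ s * h s)).fun_sub
    (intervalIntegral.integral_hasDerivAt_right (hh.intervalIntegrable_decSol hμ hr hr)
      (hh.stronglyMeasurableAtFilter continuousOn_decSol hr)
      ((hasDerivAt_decSol hr).continuousAt.mul hc))

lemma hasDerivAt_integral_Ioc (hh : IsSource μ C h) (hμ : 0 < μ) (hr : 0 < r)
    (hc : ContinuousAt h r) :
    HasDerivAt (fun x => ∫ s in Ioc 0 x, regSol μ s * h s) (regSol μ r * h r) r := by
  refine HasDerivAt.congr_of_eventuallyEq ?_ (eventually_integral_Ioc_eq hr)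
  exact intervalIntegral.integral_hasDerivAt_right (hh.intervalIntegrable_regSol hμ hr.le)
      (hh.stronglyMeasurableAtFilter continuousOn_regSol hr)
      ((hasDerivAt_regSol hr).continuousAt.mul hc)

lemma hasDerivAt_green (hh : IsSource μ C h) (hμ : 0 < μ) (hr : 0 < r)
    (hc : ContinuousAt h r) : HasDerivAt (green μ h) (greenDeriv μ h r) r := by
  have h1 := (((hasDerivAt_regSol (μ := μ) hr).mul (hasDerivAt_integral_Ioi hh hμ hr hc)).add
    ((hasDerivAt_decSol (μ := μ) hr).mul (hasDerivAt_integral_Ioc hh hμ hr hc))).const_mul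
    (μ ^ 3)⁻¹
  refine h1.congr_deriv ?_
  unfold greenDeriv
  ring

lemma hasDerivAt_greenDeriv (hh : IsSource μ C h) (hμ : 0 < μ) (hr : 0 < r)
    (hc : ContinuousAt h r) :
    HasDerivAt (greenDeriv μ h) (pot μ r * green μ h r - h r) r := by
  have h1 := (((hasDerivAt_regSolDeriv (μ := μ) hr).mul
    (hasDerivAt_integral_Ioi hh hμ hr hc)).add
    ((hasDerivAt_decSolDeriv (μ := μ) hr).mul (hasDerivAt_integral_Ioc hh hμ hr hc))).const_mul
    (μ ^ 3)⁻¹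
  refine h1.congr_deriv ?_
  unfold green
  have hw := wronskian_eq (μ := μ) hr
  have h3 : (μ ^ 3)⁻¹ * μ ^ 3 = 1 := inv_mul_cancel₀ (by positivity)
  linear_combination (-(μ ^ 3)⁻¹ * h r) * hw - h r * h3

/-- Dominated convergence, with the common majorant `C (1 + s) pot μ s`. -/
lemma tendsto_green {F : ℕ → ℝ → ℝ} (hF : ∀ n, IsSource μ C (F n))
    (hμ : 0 < μ) (hlim : ∀ s, 0 < s → Tendsto (fun n => F n s) atTop (𝓝 (h s))) (hr : 0 < r) :
    Tendsto (fun n => green μ (F n) r) atTop (𝓝 (green μ h r)) := by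
  have h1 : Tendsto (fun n => ∫ s in Ioi r, decSol μ s * F n s) atTop
      (𝓝 (∫ s in Ioi r, decSol μ s * h s)) := by
    refine tendsto_integral_of_dominated_convergence
      (fun s => C * (decSol μ s * ((1 + s) * pot μ s)))
      (fun n => ((hF n).integrableOn_decSol hμ hr).aestronglyMeasurable)
      ((integrableOn_decSol_mul_max hμ hr).const_mul C) (fun n => ?_) ?_
    · refine (ae_restrict_iff' measurableSet_Ioi).2 (ae_of_all _ fun s hs => ?_)
      have h0 := (decSol_pos hμ (hr.trans hs)).le
      rw [Real.norm_of_nonneg (mul_nonneg h0 ((hF n).nonneg s (hr.trans hs)))]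
      linarith [mul_le_mul_of_nonneg_left ((hF n).le s (hr.trans hs)) h0]
    · exact (ae_restrict_iff' measurableSet_Ioi).2 (ae_of_all _ fun s hs =>
        (hlim s (hr.trans hs)).const_mul _)
  have h2 : Tendsto (fun n => ∫ s in Ioc 0 r, regSol μ s * F n s) atTop
      (𝓝 (∫ s in Ioc 0 r, regSol μ s * h s)) := by
    refine tendsto_integral_of_dominated_convergence
      (fun s => C * (regSol μ s * ((1 + s) * pot μ s)))
      (fun n => ((hF n).integrableOn_regSol hμ).aestronglyMeasurable)
      ((integrableOn_regSol_mul_max hμ).const_mul C) (fun n => ?_) ?_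
    · refine (ae_restrict_iff' measurableSet_Ioc).2 (ae_of_all _ fun s hs => ?_)
      have h0 := regSol_nonneg hμ hs.1
      rw [Real.norm_of_nonneg (mul_nonneg h0 ((hF n).nonneg s hs.1))]
      linarith [mul_le_mul_of_nonneg_left ((hF n).le s hs.1) h0]
    · exact (ae_restrict_iff' measurableSet_Ioc).2 (ae_of_all _ fun s hs =>
        (hlim s hs.1).const_mul _)
  exact ((h1.const_mul _).add (h2.const_mul _)).const_mul _

lemma IsSource.of_tendsto {F : ℕ → ℝ → ℝ} (hF : ∀ n, IsSource μ C (F n))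
    (hlim : ∀ s, 0 < s → Tendsto (fun n => F n s) atTop (𝓝 (h s))) : IsSource μ C h where
  aesm := aestronglyMeasurable_of_tendsto_ae atTop (fun n => (hF n).aesm)
    ((ae_restrict_iff' measurableSet_Ioi).2 (ae_of_all _ hlim))
  nonneg s hs := ge_of_tendsto' (hlim s hs) fun n => (hF n).nonneg s hs
  le s hs := le_of_tendsto' (hlim s hs) fun n => (hF n).le s hs

/-! ### Maximum principle. -/

/-- A function whose derivative vanishes and decreases at a point has no local minimum there. -/
lemma not_isLocalMin_of_second_deriv_neg {u v : ℝ → ℝ} {a x : ℝ}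
    (hu : ∀ᶠ y in 𝓝 x, HasDerivAt u (v y) y) (hv : HasDerivAt v a x) (ha : a < 0) :
    ¬ IsLocalMin u x := fun hmin => by
  have hv0 : v x = 0 := hmin.hasDerivAt_eq_zero hu.self_of_nhds
  have hneg : ∀ᶠ y in 𝓝[>] x, v y < 0 := by
    have := (hasDerivAt_iff_tendsto_slope.1 hv).eventually (gt_mem_nhds ha)
    have := this.filter_mono (nhdsWithin_mono x fun y (hy : x < y) => hy.ne')
    filter_upwards [this, self_mem_nhdsWithin] with y hy hxy
    rw [slope_def_field, hv0, sub_zero, div_neg_iff] at hy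
    have : 0 < y - x := sub_pos.2 hxy
    rcases hy with h | h <;> linarith
  obtain ⟨b, hxb, hb⟩ := mem_nhdsGT_iff_exists_Ioo_subset.1
    ((hneg.and (hu.filter_mono nhdsWithin_le_nhds)).and (hmin.filter_mono nhdsWithin_le_nhds))
  have hxb' : x < b := hxb
  set c := (x + b) / 2
  have hxc : x < c := by simp only [c]; linarith
  have hcb : c < b := by simp only [c]; linarith
  obtain ⟨d, hd, hdeq⟩ := exists_hasDerivAt_eq_slope u v hxc
    (fun y hy => by
      rcases hy.1.eq_or_lt with rfl | hy1
      · exact hu.self_of_nhds.continuousAt.continuousWithinAt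
      · exact (hb ⟨hy1, hy.2.trans_lt hcb⟩).1.2.continuousAt.continuousWithinAt)
    (fun y hy => (hb ⟨hy.1, hy.2.trans hcb⟩).1.2)
  have h1 : v d < 0 := (hb ⟨hd.1, hd.2.trans hcb⟩).1.1
  have h2 : u x ≤ u c := (hb ⟨hxc, hcb⟩).2
  rw [hdeq] at h1
  have : 0 ≤ (u c - u x) / (c - x) := div_nonneg (by linarith) (by linarith)
  linarith

/-- Maximum principle for `u ↦ -u'' + pot μ u` on the half-line, for functions of at most linear
negative growth. -/
lemma nonneg_of_deriv_le {d d₁ d₂ : ℝ → ℝ} (hd : ∀ r, 0 < r → HasDerivAt d (d₁ r) r)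
    (hd₁ : ∀ r, 0 < r → HasDerivAt d₁ (d₂ r) r) (hd₂ : ∀ r, 0 < r → d₂ r ≤ pot μ r * d r)
    (hC : ∀ r, 0 < r → -(C * (1 + r)) ≤ d r) (hr : 0 < r) : 0 ≤ d r := by
  by_contra! hneg
  -- Both `1 / r` and `r ^ 2` solve `u'' = 2 u / r²`, so adding a small multiple of their sum
  -- preserves the differential inequality. The sum blows up at `0` and outgrows linear functions at
  -- infinity, so a negative value forces an interior minimum.
  obtain ⟨ε, hε, hεr⟩ : ∃ ε, 0 < ε ∧ d r + ε * (1 / r + r ^ 2) < 0 := by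
    have hb : 0 < 1 / r + r ^ 2 := by positivity
    refine ⟨-d r / (2 * (1 / r + r ^ 2)), div_pos (by linarith) (by linarith), ?_⟩
    have : -d r / (2 * (1 / r + r ^ 2)) * (1 / r + r ^ 2) = -d r / 2 := by field_simp
    linarith
  set g : ℝ → ℝ := fun x => d x + ε * (1 / x + x ^ 2) with hg
  set g₁ : ℝ → ℝ := fun x => d₁ x + ε * (-1 / x ^ 2 + 2 * x) with hg₁
  have hgd : ∀ x, 0 < x → HasDerivAt g (g₁ x) x := fun x hx => by
    have h := (hd x hx).add ((((hasDerivAt_const x (1 : ℝ)).div (hasDerivAt_id x) hx.ne').add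
      ((hasDerivAt_id x).pow 2)).const_mul ε)
    refine h.congr_deriv ?_
    simp [hg₁]
  have hg₁d : ∀ x, 0 < x → HasDerivAt g₁ (d₂ x + ε * (2 / x ^ 3 + 2)) x := fun x hx => by
    have h := (hd₁ x hx).add ((((hasDerivAt_const x (-1 : ℝ)).div ((hasDerivAt_id x).pow 2)
      (pow_ne_zero 2 hx.ne')).add ((hasDerivAt_id x).const_mul 2)).const_mul ε)
    refine h.congr_deriv ?_
    simp only [Pi.pow_apply, id]
    push_cast
    field_simp
    ring
  have hC' : ∀ x, 0 < x → -(|C| * (1 + x)) ≤ d x := fun x hx => by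
    have := mul_le_mul_of_nonneg_right (le_abs_self C) (by positivity : 0 ≤ 1 + x)
    linarith [hC x hx]
  have hC0 := abs_nonneg C
  -- At `α` the term `ε / r`, at `β` the term `ε r²`, outweighs `|C| (1 + r)`, so `g` is nonnegative
  -- at both ends.
  set α := min r (min 1 (ε / (2 * |C| + 1))) with hα
  set β := max r (1 + (2 * |C| + 1) / ε) with hβ
  have hα0 : 0 < α := lt_min hr (lt_min one_pos (by positivity))
  have hgα : 0 ≤ g α := by
    have h1 : α ≤ 1 := (min_le_right _ _).trans (min_le_left _ _)
    have h2 : α ≤ ε / (2 * |C| + 1) := (min_le_right _ _).trans (min_le_right _ _)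
    rw [le_div_iff₀ (by positivity)] at h2
    have h3 : 2 * |C| ≤ ε * (1 / α) := by
      rw [mul_one_div, le_div_iff₀ hα0]
      nlinarith
    have := hC' α hα0
    have : 0 ≤ ε * α ^ 2 := by positivity
    simp only [hg]
    nlinarith
  have hβ0 : 0 < β := hr.trans_le (le_max_left _ _)
  have hgβ : 0 ≤ g β := by
    have h1 : 1 + (2 * |C| + 1) / ε ≤ β := le_max_right _ _
    have h0 : 0 < (2 * |C| + 1) / ε := by positivity
    have h2 : (2 * |C| + 1) / ε ≤ β := by linarith
    rw [div_le_iff₀ hε] at h2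
    have h3 : 1 ≤ β := by linarith
    have := hC' β hβ0
    have : 0 ≤ ε * (1 / β) := by positivity
    simp only [hg]
    nlinarith
  have hαr : α ≤ r := min_le_left _ _
  have hrβ : r ≤ β := le_max_left _ _
  obtain ⟨x, hx, hxmin⟩ := isCompact_Icc.exists_isMinOn (nonempty_Icc.2 (hαr.trans hrβ))
    (f := g) fun x hx => (hgd x (hα0.trans_le hx.1)).continuousAt.continuousWithinAt
  have hgx : g x < 0 := (hxmin ⟨hαr, hrβ⟩).trans_lt hεr
  have hxα : α < x := lt_of_le_of_ne hx.1 fun h => by rw [← h] at hgx; linarith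
  have hxβ : x < β := lt_of_le_of_ne hx.2 fun h => by rw [h] at hgx; linarith
  have hx0 : 0 < x := hα0.trans hxα
  refine not_isLocalMin_of_second_deriv_neg
    (by filter_upwards [Ioi_mem_nhds hx0] with y hy using hgd y hy) (hg₁d x hx0) ?_
    (hxmin.isLocalMin (Icc_mem_nhds hxα hxβ))
  have h1 := hd₂ x hx0
  have h2 : pot μ x * d x < pot μ x * (-(ε * (1 / x + x ^ 2))) :=
    mul_lt_mul_of_pos_left (by simp only [hg] at hgx; linarith) (pot_pos hx0)
  have h3 : pot μ x * (ε * (1 / x + x ^ 2)) =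
      ε * (2 / x ^ 3 + 2) + ε * (μ ^ 2 * (1 / x + x ^ 2)) := by
    unfold pot
    field_simp
  have h4 : 0 ≤ ε * (μ ^ 2 * (1 / x + x ^ 2)) := by positivity
  linarith

end Monopole

/-! ### Comparison lemmas and the cooperative form of the system. -/

namespace Monopole

variable {μ r C lam ρ₀ g₀ : ℝ} {h : ℝ → ℝ}

lemma le_green {v v₁ v₂ : ℝ → ℝ} {C' : ℝ} (hh : IsSource μ C h) (hμ : 0 < μ)
    (hc : ContinuousOn h (Ioi 0)) (hv : ∀ r, 0 < r → HasDerivAt v (v₁ r) r)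
    (hv₁ : ∀ r, 0 < r → HasDerivAt v₁ (v₂ r) r)
    (hv₂ : ∀ r, 0 < r → pot μ r * v r - h r ≤ v₂ r) (hC : ∀ r, 0 < r → v r ≤ C' * (1 + r))
    (hr : 0 < r) : v r ≤ green μ h r := by
  have hc' : ∀ r, 0 < r → ContinuousAt h r := fun r hr => hc.continuousAt (Ioi_mem_nhds hr)
  have := nonneg_of_deriv_le (μ := μ) (C := C')
    (fun r hr => (hasDerivAt_green hh hμ hr (hc' r hr)).sub (hv r hr))
    (fun r hr => (hasDerivAt_greenDeriv hh hμ hr (hc' r hr)).sub (hv₁ r hr))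
    (fun r hr => by simp only [Pi.sub_apply]; linarith [hv₂ r hr])
    (fun r hr => by simp only [Pi.sub_apply]; linarith [hC r hr, green_nonneg hh hμ hr]) hr
  simpa using this

lemma green_le_of_deriv_le {v v₁ v₂ : ℝ → ℝ} (hh : IsSource μ C h) (hμ : 0 < μ)
    (hc : ContinuousOn h (Ioi 0)) (hv : ∀ r, 0 < r → HasDerivAt v (v₁ r) r)
    (hv₁ : ∀ r, 0 < r → HasDerivAt v₁ (v₂ r) r)
    (hv₂ : ∀ r, 0 < r → v₂ r ≤ pot μ r * v r - h r) (h0 : ∀ r, 0 < r → 0 ≤ v r)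
    (hr : 0 < r) : green μ h r ≤ v r := by
  have hc' : ∀ r, 0 < r → ContinuousAt h r := fun r hr => hc.continuousAt (Ioi_mem_nhds hr)
  have := nonneg_of_deriv_le (μ := μ) (C := C)
    (fun r hr => (hv r hr).sub (hasDerivAt_green hh hμ hr (hc' r hr)))
    (fun r hr => (hv₁ r hr).sub (hasDerivAt_greenDeriv hh hμ hr (hc' r hr)))
    (fun r hr => by simp only [Pi.sub_apply]; linarith [hv₂ r hr])
    (fun r hr => by simp only [Pi.sub_apply]; linarith [h0 r hr, green_le hh hμ hr]) hr
  simpa using this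

/-- The equation for `f`, in terms of `f` and `w = r ρ`, reads `-f'' + pot μ f = srcF`. -/
noncomputable def srcF (g₀ μ : ℝ) (f w : ℝ → ℝ) (r : ℝ) : ℝ :=
  f r * (pot μ r + (1 - f r ^ 2) / r ^ 2 - g₀ ^ 2 * (w r / r) ^ 2)

/-- The equation for `ρ`, in terms of `f` and `w = r ρ`, reads `-w'' + pot μ w = srcW`. -/
noncomputable def srcW (lam ρ₀ μ : ℝ) (f w : ℝ → ℝ) (r : ℝ) : ℝ :=
  w r * (pot μ r - 2 * f r ^ 2 / r ^ 2 - lam * ((w r / r) ^ 2 - ρ₀ ^ 2))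

/-- The pointwise bounds `0 ≤ f ≤ 1` and `0 ≤ w ≤ ρ₀ r`. -/
structure InRange (ρ₀ : ℝ) (f w : ℝ → ℝ) : Prop where
  f_nonneg : ∀ r, 0 < r → 0 ≤ f r
  f_le : ∀ r, 0 < r → f r ≤ 1
  w_nonneg : ∀ r, 0 < r → 0 ≤ w r
  w_le : ∀ r, 0 < r → w r ≤ ρ₀ * r

/-- The choice of `μ` that makes the sources monotone. -/
structure Params (lam ρ₀ g₀ μ : ℝ) : Prop where
  lam_pos : 0 < lam
  ρ₀_pos : 0 < ρ₀
  g₀_pos : 0 < g₀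
  μ_pos : 0 < μ
  μ_sq : μ ^ 2 = g₀ ^ 2 * ρ₀ ^ 2 + 2 * lam * ρ₀ ^ 2

lemma srcF_mono (P : Params lam ρ₀ g₀ μ) {f w F W : ℝ → ℝ} (hz : InRange ρ₀ f w)
    (hZ : InRange ρ₀ F W) (hr : 0 < r) (hf : f r ≤ F r) (hw : W r ≤ w r) :
    srcF g₀ μ f w r ≤ srcF g₀ μ F W r := by
  have f0 := hz.f_nonneg r hr
  have F1 := hZ.f_le r hr
  have hp : w r / r ≤ ρ₀ := (div_le_iff₀ hr).2 (hz.w_le r hr)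
  have hPp : W r / r ≤ w r / r := by gcongr
  have hP0 : 0 ≤ W r / r := div_nonneg (hZ.w_nonneg r hr) hr.le
  unfold srcF pot
  rw [P.μ_sq]
  generalize w r / r = p at *
  generalize W r / r = q at *
  generalize f r = f at *
  generalize F r = F at *
  -- The `2 / r²` of `pot` absorbs the cubic term because `f, F ≤ 1`; the `g₀² ρ₀²` in `μ²` absorbs
  -- `g₀² p²` because `p ≤ ρ₀`.
  have key : 0 ≤ (F - f) * ((3 - F ^ 2 - F * f - f ^ 2) / r ^ 2 + g₀ ^ 2 * (ρ₀ ^ 2 - p ^ 2) +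
      2 * lam * ρ₀ ^ 2) + F * (g₀ ^ 2 * (p ^ 2 - q ^ 2)) := by
    have h1 : 0 ≤ 3 - F ^ 2 - F * f - f ^ 2 := by nlinarith
    have h2 : 0 ≤ ρ₀ ^ 2 - p ^ 2 := by nlinarith
    have h3 : 0 ≤ p ^ 2 - q ^ 2 := by nlinarith
    have h4 : 0 ≤ F - f := by linarith
    have h5 : 0 ≤ F := by linarith
    have := P.lam_pos
    positivity
  have e : (3 - F ^ 2 - F * f - f ^ 2) / r ^ 2 = 2 / r ^ 2 + (1 - F ^ 2 - F * f - f ^ 2) / r ^ 2 :=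
    by ring
  rw [← sub_nonneg]
  refine key.trans (le_of_eq ?_)
  ring

lemma srcW_anti (P : Params lam ρ₀ g₀ μ) {f w F W : ℝ → ℝ} (hz : InRange ρ₀ f w)
    (hZ : InRange ρ₀ F W) (hr : 0 < r) (hf : f r ≤ F r) (hw : W r ≤ w r) :
    srcW lam ρ₀ μ F W r ≤ srcW lam ρ₀ μ f w r := by
  have f0 := hz.f_nonneg r hr
  have F1 := hZ.f_le r hr
  have hp : w r / r ≤ ρ₀ := (div_le_iff₀ hr).2 (hz.w_le r hr)
  have hPp : W r / r ≤ w r / r := by gcongr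
  have hP0 : 0 ≤ W r / r := div_nonneg (hZ.w_nonneg r hr) hr.le
  have e1 : w r = r * (w r / r) := by field_simp
  have e2 : W r = r * (W r / r) := by field_simp
  unfold srcW pot
  rw [P.μ_sq]
  generalize w r / r = p at *
  generalize W r / r = q at *
  rw [e1, e2]
  generalize f r = f at *
  generalize F r = F at *
  -- Here `2 / r²` absorbs `2 f² / r²`, and `2 lam ρ₀²` in `μ²` raises `ρ₀²` to `3 ρ₀²`, which
  -- dominates `p² + p q + q²`.
  have key : 0 ≤ r * ((p - q) * (2 * (1 - f ^ 2) / r ^ 2 + g₀ ^ 2 * ρ₀ ^ 2 +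
      lam * (3 * ρ₀ ^ 2 - p ^ 2 - p * q - q ^ 2)) + 2 * q * (F ^ 2 - f ^ 2) / r ^ 2) := by
    have h1 : 0 ≤ 1 - f ^ 2 := by nlinarith
    have h2 : 0 ≤ 3 * ρ₀ ^ 2 - p ^ 2 - p * q - q ^ 2 := by nlinarith
    have h3 : 0 ≤ F ^ 2 - f ^ 2 := by nlinarith
    have h4 : 0 ≤ p - q := by linarith
    have := P.lam_pos
    positivity
  rw [← sub_nonneg]
  refine key.trans (le_of_eq ?_)
  ring

/-- The pairs `(1, 0)` and `(0, ρ₀ r)` are the greatest and the least in range, so monotonicity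
bounds every source by its values at them. -/
lemma inRange_one_zero (P : Params lam ρ₀ g₀ μ) : InRange ρ₀ (fun _ => 1) (fun _ => 0) where
  f_nonneg _ _ := zero_le_one
  f_le _ _ := le_rfl
  w_nonneg _ _ := le_rfl
  w_le _ hr := (mul_pos P.ρ₀_pos hr).le

lemma inRange_zero_linear (P : Params lam ρ₀ g₀ μ) :
    InRange ρ₀ (fun _ => 0) (fun r => ρ₀ * r) where
  f_nonneg _ _ := le_rfl
  f_le _ _ := zero_le_one
  w_nonneg _ hr := (mul_pos P.ρ₀_pos hr).le
  w_le _ _ := le_rfl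

namespace InRange

variable {f w : ℝ → ℝ}

lemma srcF_le (hz : InRange ρ₀ f w) (P : Params lam ρ₀ g₀ μ) (hr : 0 < r) :
    srcF g₀ μ f w r ≤ pot μ r := by
  have := srcF_mono P hz (inRange_one_zero P) hr (hz.f_le r hr) (hz.w_nonneg r hr)
  simpa [srcF] using this

lemma srcF_nonneg (hz : InRange ρ₀ f w) (P : Params lam ρ₀ g₀ μ) (hr : 0 < r) :
    0 ≤ srcF g₀ μ f w r := by
  have := srcF_mono P (inRange_zero_linear P) hz hr (hz.f_nonneg r hr) (hz.w_le r hr)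
  simpa [srcF] using this

lemma srcW_le (hz : InRange ρ₀ f w) (P : Params lam ρ₀ g₀ μ) (hr : 0 < r) :
    srcW lam ρ₀ μ f w r ≤ pot μ r * (ρ₀ * r) := by
  have := srcW_anti P (inRange_zero_linear P) hz hr (hz.f_nonneg r hr) (hz.w_le r hr)
  refine this.trans (le_of_eq ?_)
  simp [srcW, hr.ne']
  ring

lemma srcW_nonneg (hz : InRange ρ₀ f w) (P : Params lam ρ₀ g₀ μ) (hr : 0 < r) :
    0 ≤ srcW lam ρ₀ μ f w r := by
  have := srcW_anti P hz (inRange_one_zero P) hr (hz.f_le r hr) (hz.w_nonneg r hr)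
  simpa [srcW] using this

end InRange

section

variable {f w : ℝ → ℝ}

lemma continuousOn_srcF (hf : ContinuousOn f (Ioi 0)) (hw : ContinuousOn w (Ioi 0)) :
    ContinuousOn (srcF g₀ μ f w) (Ioi 0) := by
  have hne : ∀ x ∈ Ioi (0 : ℝ), x ≠ 0 := fun x hx => ne_of_gt hx
  refine hf.mul ((continuousOn_pot.add ((continuousOn_const.sub (hf.pow 2)).div
    (continuousOn_id.pow 2) fun x hx => pow_ne_zero 2 (hne x hx))).sub
    (continuousOn_const.mul ((hw.div continuousOn_id hne).pow 2)))

lemma continuousOn_srcW (hf : ContinuousOn f (Ioi 0)) (hw : ContinuousOn w (Ioi 0)) :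
    ContinuousOn (srcW lam ρ₀ μ f w) (Ioi 0) := by
  have hne : ∀ x ∈ Ioi (0 : ℝ), x ≠ 0 := fun x hx => ne_of_gt hx
  refine hw.mul ((continuousOn_pot.sub ((continuousOn_const.mul (hf.pow 2)).div
    (continuousOn_id.pow 2) fun x hx => pow_ne_zero 2 (hne x hx))).sub
    (continuousOn_const.mul (((hw.div continuousOn_id hne).pow 2).sub continuousOn_const)))

lemma isSource_srcF (P : Params lam ρ₀ g₀ μ) (hz : InRange ρ₀ f w)
    (hf : ContinuousOn f (Ioi 0)) (hw : ContinuousOn w (Ioi 0)) :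
    IsSource μ 1 (srcF g₀ μ f w) where
  aesm := (continuousOn_srcF hf hw).aestronglyMeasurable measurableSet_Ioi
  nonneg _ hr := hz.srcF_nonneg P hr
  le r hr := by nlinarith [hz.srcF_le P hr, pot_pos (μ := μ) hr]

lemma isSource_srcW (P : Params lam ρ₀ g₀ μ) (hz : InRange ρ₀ f w)
    (hf : ContinuousOn f (Ioi 0)) (hw : ContinuousOn w (Ioi 0)) :
    IsSource μ ρ₀ (srcW lam ρ₀ μ f w) where
  aesm := (continuousOn_srcW hf hw).aestronglyMeasurable measurableSet_Ioi
  nonneg _ hr := hz.srcW_nonneg P hr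
  le r hr := by nlinarith [hz.srcW_le P hr, mul_pos (pot_pos (μ := μ) hr) P.ρ₀_pos]

end

/-! ### Monotone iteration and the minimal solution. -/

/-- Smooth upper pairs of the cooperative system in `(f, -w)`. -/
structure IsUpperPair (lam ρ₀ g₀ μ : ℝ) (F W : ℝ → ℝ) : Prop where
  inRange : InRange ρ₀ F W
  deriv_F : ∃ F₁ F₂ : ℝ → ℝ, (∀ r, 0 < r → HasDerivAt F (F₁ r) r) ∧
    (∀ r, 0 < r → HasDerivAt F₁ (F₂ r) r) ∧
    ∀ r, 0 < r → F₂ r ≤ pot μ r * F r - srcF g₀ μ F W r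
  deriv_W : ∃ W₁ W₂ : ℝ → ℝ, (∀ r, 0 < r → HasDerivAt W (W₁ r) r) ∧
    (∀ r, 0 < r → HasDerivAt W₁ (W₂ r) r) ∧
    ∀ r, 0 < r → pot μ r * W r - srcW lam ρ₀ μ F W r ≤ W₂ r

/-- The sequence of successive approximations, starting from the lower pair
`(exp (-g₀ ρ₀ r), ρ₀ r)`. -/
noncomputable def approx (lam ρ₀ g₀ μ : ℝ) : ℕ → (ℝ → ℝ) × (ℝ → ℝ)
  | 0 => (fun r => Real.exp (-(g₀ * ρ₀ * r)), fun r => ρ₀ * r)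
  | n + 1 => (green μ (srcF g₀ μ (approx lam ρ₀ g₀ μ n).1 (approx lam ρ₀ g₀ μ n).2),
      green μ (srcW lam ρ₀ μ (approx lam ρ₀ g₀ μ n).1 (approx lam ρ₀ g₀ μ n).2))

structure IsRegular (ρ₀ : ℝ) (z : (ℝ → ℝ) × (ℝ → ℝ)) : Prop where
  inRange : InRange ρ₀ z.1 z.2
  cont₁ : ContinuousOn z.1 (Ioi 0)
  cont₂ : ContinuousOn z.2 (Ioi 0)

/-- The range is preserved since `1` and `ρ₀ r` are supersolutions for the respective sources. -/
lemma isRegular_approx (P : Params lam ρ₀ g₀ μ) (n : ℕ) :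
    IsRegular ρ₀ (approx lam ρ₀ g₀ μ n) := by
  induction n with
  | zero =>
    refine ⟨⟨fun r hr => (Real.exp_pos _).le, fun r hr => ?_, fun r hr => ?_, fun r hr => le_rfl⟩,
      ?_, ?_⟩
    · have := mul_pos (mul_pos P.g₀_pos P.ρ₀_pos) hr
      exact Real.exp_le_one_iff.2 (by linarith)
    · exact (mul_pos P.ρ₀_pos hr).le
    · unfold approx; fun_prop
    · unfold approx; fun_prop
  | succ n ih =>
    have hF := isSource_srcF P ih.inRange ih.cont₁ ih.cont₂
    have hW := isSource_srcW P ih.inRange ih.cont₁ ih.cont₂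
    have cF := continuousOn_srcF (g₀ := g₀) (μ := μ) ih.cont₁ ih.cont₂
    have cW := continuousOn_srcW (lam := lam) (ρ₀ := ρ₀) (μ := μ) ih.cont₁ ih.cont₂
    refine ⟨⟨fun r hr => green_nonneg hF P.μ_pos hr, fun r hr => ?_,
      fun r hr => green_nonneg hW P.μ_pos hr, fun r hr => ?_⟩,
      continuousOn_green hF P.μ_pos, continuousOn_green hW P.μ_pos⟩
    · exact green_le_of_deriv_le (v := fun _ => 1) hF P.μ_pos cF
        (fun r _ => hasDerivAt_const r _) (fun r _ => hasDerivAt_const r _)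
        (fun r hr => by linarith [ih.inRange.srcF_le P hr]) (fun _ _ => zero_le_one) hr
    · exact green_le_of_deriv_le (v := fun r => ρ₀ * r) (v₁ := fun _ => ρ₀) hW P.μ_pos cW
        (fun r _ => by simpa using (hasDerivAt_id r).const_mul ρ₀)
        (fun r _ => hasDerivAt_const r _)
        (fun r hr => by linarith [ih.inRange.srcW_le P hr])
        (fun r hr => (mul_pos P.ρ₀_pos hr).le) hr

/-- The order of the cooperative system. -/
def PairLE (z z' : (ℝ → ℝ) × (ℝ → ℝ)) : Prop := ∀ r, 0 < r → z.1 r ≤ z'.1 r ∧ z'.2 r ≤ z.2 r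

lemma approx_succ_mono (P : Params lam ρ₀ g₀ μ) {m n : ℕ}
    (hle : PairLE (approx lam ρ₀ g₀ μ m) (approx lam ρ₀ g₀ μ n)) :
    PairLE (approx lam ρ₀ g₀ μ (m + 1)) (approx lam ρ₀ g₀ μ (n + 1)) := by
  have hm := isRegular_approx P m
  have hn := isRegular_approx P n
  refine fun r hr => ⟨?_, ?_⟩
  · exact green_mono (isSource_srcF P hm.inRange hm.cont₁ hm.cont₂)
      (isSource_srcF P hn.inRange hn.cont₁ hn.cont₂) P.μ_pos
      (fun s hs => srcF_mono P hm.inRange hn.inRange hs (hle s hs).1 (hle s hs).2) hr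
  · exact green_mono (isSource_srcW P hn.inRange hn.cont₁ hn.cont₂)
      (isSource_srcW P hm.inRange hm.cont₁ hm.cont₂) P.μ_pos
      (fun s hs => srcW_anti P hm.inRange hn.inRange hs (hle s hs).1 (hle s hs).2) hr

/-- For the base case, the exponential solves `v'' = g₀² ρ₀² v`, which differs from the equation
with `ρ = ρ₀` only by the nonpositive term `v (v² - 1) / r²`. Induction then uses order
preservation. -/
lemma approx_le_succ (P : Params lam ρ₀ g₀ μ) (n : ℕ) :
    PairLE (approx lam ρ₀ g₀ μ n) (approx lam ρ₀ g₀ μ (n + 1)) := by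
  induction n with
  | succ n ih => exact approx_succ_mono P ih
  | zero =>
    have h0 := isRegular_approx P 0
    refine fun r hr => ⟨?_, ?_⟩
    · refine le_green (isSource_srcF P h0.inRange h0.cont₁ h0.cont₂) P.μ_pos (C' := 1)
        (continuousOn_srcF h0.cont₁ h0.cont₂) (fun r _ => hasDerivAt_exp_neg_mul)
        (fun r _ => (hasDerivAt_exp_neg_mul.const_mul (g₀ * ρ₀)).fun_neg) (fun r hr => ?_)
        (fun r hr => ?_) hr
      · have h1 := h0.inRange.f_le r hr
        simp only [approx, srcF] at h1 ⊢
        have h2 := Real.exp_pos (-(g₀ * ρ₀ * r))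
        generalize Real.exp (-(g₀ * ρ₀ * r)) = e at *
        have h3 : 0 ≤ e * ((1 - e ^ 2) / r ^ 2) := by
          have : 0 ≤ 1 - e ^ 2 := by nlinarith
          positivity
        have h4 : ρ₀ * r / r = ρ₀ := by field_simp
        rw [h4]
        linarith
      · linarith [h0.inRange.f_le r hr]
    · refine green_le_of_deriv_le (isSource_srcW P h0.inRange h0.cont₁ h0.cont₂) P.μ_pos
        (v := fun r => ρ₀ * r) (v₁ := fun _ => ρ₀) (continuousOn_srcW h0.cont₁ h0.cont₂)
        (fun r _ => by simpa using (hasDerivAt_id r).const_mul ρ₀)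
        (fun r _ => hasDerivAt_const r _)
        (fun r hr => by linarith [h0.inRange.srcW_le P hr])
        (fun r hr => (mul_pos P.ρ₀_pos hr).le) hr

lemma approx_le_of_isUpperPair (P : Params lam ρ₀ g₀ μ) {F W : ℝ → ℝ}
    (hU : IsUpperPair lam ρ₀ g₀ μ F W) (h0 : PairLE (approx lam ρ₀ g₀ μ 0) (F, W)) (n : ℕ) :
    PairLE (approx lam ρ₀ g₀ μ n) (F, W) := by
  induction n with
  | zero => exact h0
  | succ n ih =>
    have hn := isRegular_approx P n
    obtain ⟨F₁, F₂, hF, hF₁, hF₂⟩ := hU.deriv_F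
    obtain ⟨W₁, W₂, hW, hW₁, hW₂⟩ := hU.deriv_W
    refine fun r hr => ⟨?_, ?_⟩
    · refine green_le_of_deriv_le (isSource_srcF P hn.inRange hn.cont₁ hn.cont₂) P.μ_pos
        (continuousOn_srcF hn.cont₁ hn.cont₂) hF hF₁ (fun r hr => ?_) hU.inRange.f_nonneg hr
      linarith [hF₂ r hr, srcF_mono P hn.inRange hU.inRange hr (ih r hr).1 (ih r hr).2]
    · refine le_green (isSource_srcW P hn.inRange hn.cont₁ hn.cont₂) P.μ_pos (C' := ρ₀)
        (continuousOn_srcW hn.cont₁ hn.cont₂) hW hW₁ (fun r hr => ?_) (fun r hr => ?_) hr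
      · linarith [hW₂ r hr, srcW_anti P hn.inRange hU.inRange hr (ih r hr).1 (ih r hr).2]
      · linarith [hU.inRange.w_le r hr, P.ρ₀_pos]

/-- The system in terms of `f` and `w = r ρ`, with `f₁` and `w₁` the first derivatives. -/
structure IsReducedSolution (lam ρ₀ g₀ : ℝ) (f f₁ w w₁ : ℝ → ℝ) : Prop where
  deriv_f : ∀ r, 0 < r → HasDerivAt f (f₁ r) r
  deriv_f₁ : ∀ r, 0 < r →
    HasDerivAt f₁ (f r * ((f r ^ 2 - 1) / r ^ 2 + g₀ ^ 2 * (w r / r) ^ 2)) r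
  deriv_w : ∀ r, 0 < r → HasDerivAt w (w₁ r) r
  deriv_w₁ : ∀ r, 0 < r →
    HasDerivAt w₁ (w r * (2 * f r ^ 2 / r ^ 2 + lam * ((w r / r) ^ 2 - ρ₀ ^ 2))) r

/-- There is a least solution above the lower pair. -/
lemma exists_minimal_solution (P : Params lam ρ₀ g₀ μ) :
    ∃ f f₁ w w₁ : ℝ → ℝ, IsReducedSolution lam ρ₀ g₀ f f₁ w w₁ ∧ InRange ρ₀ f w ∧
      PairLE (approx lam ρ₀ g₀ μ 0) (f, w) ∧
      ∀ F W : ℝ → ℝ, IsUpperPair lam ρ₀ g₀ μ F W → PairLE (approx lam ρ₀ g₀ μ 0) (F, W) →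
        PairLE (f, w) (F, W) := by
  set z := approx lam ρ₀ g₀ μ with hz
  have hreg := isRegular_approx P
  have hstep := approx_le_succ P
  -- Positivity sits inside the existential so that `choose` yields a function on all of `ℝ`.
  have hf : ∀ r, ∃ l, 0 < r → Tendsto (fun n => (z n).1 r) atTop (𝓝 l) := fun r => by
    by_cases hr : 0 < r
    · refine ⟨_, fun _ => tendsto_atTop_ciSup (monotone_nat_of_le_succ fun n => (hstep n r hr).1)
        ⟨1, ?_⟩⟩
      rintro _ ⟨n, rfl⟩
      exact (hreg n).inRange.f_le r hr
    · exact ⟨0, fun h => absurd h hr⟩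
  have hw : ∀ r, ∃ l, 0 < r → Tendsto (fun n => (z n).2 r) atTop (𝓝 l) := fun r => by
    by_cases hr : 0 < r
    · refine ⟨_, fun _ => tendsto_atTop_ciInf (antitone_nat_of_succ_le fun n => (hstep n r hr).2)
        ⟨0, ?_⟩⟩
      rintro _ ⟨n, rfl⟩
      exact (hreg n).inRange.w_nonneg r hr
    · exact ⟨0, fun h => absurd h hr⟩
  choose f hf using hf
  choose w hw using hw
  have hrange : InRange ρ₀ f w :=
    ⟨fun r hr => ge_of_tendsto' (hf r hr) fun n => (hreg n).inRange.f_nonneg r hr,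
      fun r hr => le_of_tendsto' (hf r hr) fun n => (hreg n).inRange.f_le r hr,
      fun r hr => ge_of_tendsto' (hw r hr) fun n => (hreg n).inRange.w_nonneg r hr,
      fun r hr => le_of_tendsto' (hw r hr) fun n => (hreg n).inRange.w_le r hr⟩
  have hsF : ∀ n, IsSource μ 1 (srcF g₀ μ (z n).1 (z n).2) := fun n =>
    isSource_srcF P (hreg n).inRange (hreg n).cont₁ (hreg n).cont₂
  have hsW : ∀ n, IsSource μ ρ₀ (srcW lam ρ₀ μ (z n).1 (z n).2) := fun n =>
    isSource_srcW P (hreg n).inRange (hreg n).cont₁ (hreg n).cont₂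
  have limF : ∀ s, 0 < s →
      Tendsto (fun n => srcF g₀ μ (z n).1 (z n).2 s) atTop (𝓝 (srcF g₀ μ f w s)) := fun s hs =>
    (hf s hs).mul ((tendsto_const_nhds.add ((tendsto_const_nhds.sub ((hf s hs).pow 2)).div_const
      _)).sub ((((hw s hs).div_const _).pow 2).const_mul _))
  have limW : ∀ s, 0 < s →
      Tendsto (fun n => srcW lam ρ₀ μ (z n).1 (z n).2 s) atTop (𝓝 (srcW lam ρ₀ μ f w s)) :=
    fun s hs => (hw s hs).mul ((tendsto_const_nhds.sub ((((hf s hs).pow 2).const_mul _).div_const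
      _)).sub (((((hw s hs).div_const _).pow 2).sub_const _).const_mul _))
  have sF := IsSource.of_tendsto hsF limF
  have sW := IsSource.of_tendsto hsW limW
  -- The sequence shifted by one has the same limit, and its terms are the Green images of the
  -- previous iterates.
  have fixF : ∀ r, 0 < r → f r = green μ (srcF g₀ μ f w) r := fun r hr =>
    tendsto_nhds_unique ((tendsto_add_atTop_iff_nat 1).2 (hf r hr))
      (tendsto_green hsF P.μ_pos limF hr)
  have fixW : ∀ r, 0 < r → w r = green μ (srcW lam ρ₀ μ f w) r := fun r hr =>
    tendsto_nhds_unique ((tendsto_add_atTop_iff_nat 1).2 (hw r hr))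
      (tendsto_green hsW P.μ_pos limW hr)
  have cf : ContinuousOn f (Ioi 0) := (continuousOn_green sF P.μ_pos).congr fixF
  have cw : ContinuousOn w (Ioi 0) := (continuousOn_green sW P.μ_pos).congr fixW
  have csF := fun r (hr : 0 < r) => (continuousOn_srcF (g₀ := g₀) (μ := μ) cf cw).continuousAt
    (Ioi_mem_nhds hr)
  have csW := fun r (hr : 0 < r) => (continuousOn_srcW (lam := lam) (ρ₀ := ρ₀) (μ := μ) cf
    cw).continuousAt (Ioi_mem_nhds hr)
  refine ⟨f, greenDeriv μ (srcF g₀ μ f w), w, greenDeriv μ (srcW lam ρ₀ μ f w),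
    ⟨fun r hr => ?_, fun r hr => ?_, fun r hr => ?_, fun r hr => ?_⟩, hrange, fun r hr => ?_,
    fun F W hU h0 r hr => ?_⟩
  · refine (hasDerivAt_green sF P.μ_pos hr (csF r hr)).congr_of_eventuallyEq ?_
    filter_upwards [Ioi_mem_nhds hr] using fixF
  · refine (hasDerivAt_greenDeriv sF P.μ_pos hr (csF r hr)).congr_deriv ?_
    rw [← fixF r hr, srcF]
    ring
  · refine (hasDerivAt_green sW P.μ_pos hr (csW r hr)).congr_of_eventuallyEq ?_
    filter_upwards [Ioi_mem_nhds hr] using fixW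
  · refine (hasDerivAt_greenDeriv sW P.μ_pos hr (csW r hr)).congr_deriv ?_
    rw [← fixW r hr, srcW]
    ring
  · exact ⟨(monotone_nat_of_le_succ fun n => (hstep n r hr).1).ge_of_tendsto (hf r hr) 0,
      (antitone_nat_of_succ_le fun n => (hstep n r hr).2).le_of_tendsto (hw r hr) 0⟩
  · have := approx_le_of_isUpperPair P hU h0
    exact ⟨le_of_tendsto' (hf r hr) fun n => (this n r hr).1,
      ge_of_tendsto' (hw r hr) fun n => (this n r hr).2⟩

/-! ### Two families of upper pairs: the barrier and the dilations. -/

/-- The profile `r ρ` of the lower barrier `ρ = ρ₀ r² / (r² + c²)`, here with `k = c²`. -/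
lemma isUpperPair_barrier (P : Params lam ρ₀ g₀ μ) {k : ℝ} (hk : lam * ρ₀ ^ 2 * k = 6) :
    IsUpperPair lam ρ₀ g₀ μ (fun _ => 1) (fun r => ρ₀ * r ^ 3 / (r ^ 2 + k)) := by
  have hρ := P.ρ₀_pos
  have hl := P.lam_pos
  have hk0 : 0 < k := by
    by_contra! h
    have : lam * ρ₀ ^ 2 * k ≤ 0 := mul_nonpos_of_nonneg_of_nonpos (by positivity) h
    linarith
  have hq : ∀ r : ℝ, HasDerivAt (fun r => r ^ 2 + k) (2 * r) r := fun r => by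
    simpa using ((hasDerivAt_id r).pow 2).add_const k
  have hrange : InRange ρ₀ (fun _ => 1) (fun r => ρ₀ * r ^ 3 / (r ^ 2 + k)) := by
    refine ⟨fun _ _ => zero_le_one, fun _ _ => le_rfl, fun r hr => by positivity, fun r hr => ?_⟩
    rw [div_le_iff₀ (by positivity)]
    have : 0 < ρ₀ * r * k := by positivity
    nlinarith
  refine ⟨hrange, ⟨fun _ => 0, fun _ => 0, fun r _ => hasDerivAt_const r _,
    fun r _ => hasDerivAt_const r _, fun r hr => by linarith [hrange.srcF_le P hr]⟩,
    fun r => ρ₀ * (r ^ 4 + 3 * k * r ^ 2) / (r ^ 2 + k) ^ 2,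
    fun r => ρ₀ * (6 * k ^ 2 * r - 2 * k * r ^ 3) / (r ^ 2 + k) ^ 3,
    fun r hr => ?_, fun r hr => ?_, fun r hr => ?_⟩
  · have hne : r ^ 2 + k ≠ 0 := by positivity
    refine ((((hasDerivAt_id r).pow 3).const_mul ρ₀).div (hq r) hne).congr_deriv ?_
    simp only [Pi.pow_apply, id]
    push_cast
    field_simp
    ring
  · have hne : r ^ 2 + k ≠ 0 := by positivity
    have hnum : HasDerivAt (fun r => ρ₀ * (r ^ 4 + 3 * k * r ^ 2))
        (ρ₀ * (4 * r ^ 3 + 6 * k * r)) r := by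
      refine ((((hasDerivAt_id r).pow 4).add (((hasDerivAt_id r).pow 2).const_mul
        (3 * k))).const_mul ρ₀).congr_deriv ?_
      simp only [id]
      push_cast
      ring
    refine (hnum.div ((hq r).pow 2) (pow_ne_zero 2 hne)).congr_deriv ?_
    simp only [Pi.pow_apply]
    push_cast
    field_simp
    ring
  · simp only [srcW]
    rw [← sub_nonneg]
    have e : ρ₀ * (6 * k ^ 2 * r - 2 * k * r ^ 3) / (r ^ 2 + k) ^ 3 -
        (pot μ r * (ρ₀ * r ^ 3 / (r ^ 2 + k)) - ρ₀ * r ^ 3 / (r ^ 2 + k) *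
        (pot μ r - 2 * 1 ^ 2 / r ^ 2 - lam * ((ρ₀ * r ^ 3 / (r ^ 2 + k) / r) ^ 2 - ρ₀ ^ 2))) =
        ρ₀ * r * (4 * k ^ 2 + lam * ρ₀ ^ 2 * k * (k * r ^ 2) +
          2 * r ^ 4 * (lam * ρ₀ ^ 2 * k - 1) - 6 * k * r ^ 2) / (r ^ 2 + k) ^ 3 := by
      field_simp
      ring
    -- The value `lam ρ₀² k = 6` cancels the `k r²` terms and makes the `r⁴` coefficient positive.
    rw [e, hk]
    have : 4 * k ^ 2 + 6 * (k * r ^ 2) + 2 * r ^ 4 * (6 - 1) - 6 * k * r ^ 2 =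
      4 * k ^ 2 + 10 * r ^ 4 := by ring
    rw [this]
    positivity

/-- Contracting the argument of a solution yields an upper pair. -/
lemma isUpperPair_scaled {f f₁ w w₁ : ℝ → ℝ}
    (hs : IsReducedSolution lam ρ₀ g₀ f f₁ w w₁) (hz : InRange ρ₀ f w) (hlam : 0 < lam) {s : ℝ}
    (hs0 : 0 < s) (hs1 : s < 1) :
    IsUpperPair lam ρ₀ g₀ μ (fun r => f (s * r)) (fun r => w (s * r) / s) := by
  have hlin : ∀ r, HasDerivAt (fun r => s * r) s r := fun r => by
    simpa using (hasDerivAt_id r).const_mul s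
  have hs2 : s ^ 2 ≤ 1 := by nlinarith
  refine ⟨⟨fun r hr => hz.f_nonneg _ (mul_pos hs0 hr), fun r hr => hz.f_le _ (mul_pos hs0 hr),
    fun r hr => div_nonneg (hz.w_nonneg _ (mul_pos hs0 hr)) hs0.le, fun r hr => ?_⟩,
    ⟨_, _, fun r hr => (hs.deriv_f _ (mul_pos hs0 hr)).comp r (hlin r),
      fun r hr => ((hs.deriv_f₁ _ (mul_pos hs0 hr)).comp r (hlin r)).mul_const s,
      fun r hr => ?_⟩,
    ⟨_, _, fun r hr => ((hs.deriv_w _ (mul_pos hs0 hr)).comp r (hlin r)).div_const s,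
      fun r hr => (((hs.deriv_w₁ _ (mul_pos hs0 hr)).comp r (hlin r)).mul_const s).div_const s,
      fun r hr => ?_⟩⟩
  · rw [div_le_iff₀ hs0]
    linarith [hz.w_le _ (mul_pos hs0 hr)]
  · have f0 := hz.f_nonneg _ (mul_pos hs0 hr)
    simp only [srcF]
    have e : w (s * r) / s / r = w (s * r) / (s * r) := by rw [div_div]
    rw [e]
    generalize w (s * r) / (s * r) = p
    generalize f (s * r) = a at *
    -- The `1 / r²` terms are invariant under dilation; only the coupling term gains the factor `s²
    -- ≤ 1`, with the sign an upper pair needs.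
    have : 0 ≤ a * (g₀ ^ 2 * p ^ 2) * (1 - s ^ 2) := by
      have : 0 ≤ 1 - s ^ 2 := by linarith
      positivity
    have e2 : a * ((a ^ 2 - 1) / (s * r) ^ 2 + g₀ ^ 2 * p ^ 2) * s * s =
      a * ((a ^ 2 - 1) / r ^ 2) + a * (g₀ ^ 2 * p ^ 2) * s ^ 2 := by field_simp
    have e3 : (1 - a ^ 2) / r ^ 2 = -((a ^ 2 - 1) / r ^ 2) := by ring
    rw [e2, e3]
    linarith
  · have w0 := hz.w_nonneg _ (mul_pos hs0 hr)
    have hp : w (s * r) / (s * r) ≤ ρ₀ := (div_le_iff₀ (mul_pos hs0 hr)).2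
      (hz.w_le _ (mul_pos hs0 hr))
    have hp0 : 0 ≤ w (s * r) / (s * r) := div_nonneg w0 (mul_pos hs0 hr).le
    simp only [srcW]
    have e : w (s * r) / s / r = w (s * r) / (s * r) := by rw [div_div]
    rw [e]
    generalize w (s * r) / (s * r) = p at *
    generalize f (s * r) = a at *
    generalize w (s * r) = b at *
    have : 0 ≤ b / s * (lam * (ρ₀ ^ 2 - p ^ 2)) * (1 - s ^ 2) := by
      have : 0 ≤ 1 - s ^ 2 := by linarith
      have : 0 ≤ ρ₀ ^ 2 - p ^ 2 := by nlinarith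
      positivity
    have e2 : b * (2 * a ^ 2 / (s * r) ^ 2 + lam * (p ^ 2 - ρ₀ ^ 2)) * s * s / s =
      b / s * (2 * a ^ 2 / r ^ 2) + b / s * (lam * (p ^ 2 - ρ₀ ^ 2)) * s ^ 2 := by field_simp
    rw [e2]
    linarith

end Monopole

/-! ### Monotonicity and strict inequalities. -/

namespace Monopole

variable {lam ρ₀ g₀ : ℝ}

lemma mul_sub_le_of_le_deriv {u v : ℝ → ℝ} {a b c : ℝ} (hab : a < b)
    (hu : ∀ y ∈ Icc a b, HasDerivAt u (v y) y) (hv : ∀ y ∈ Ioo a b, c ≤ v y) :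
    c * (b - a) ≤ u b - u a := by
  obtain ⟨y, hy, h⟩ := exists_hasDerivAt_eq_slope u v hab
    (fun y hy => (hu y hy).continuousAt.continuousWithinAt)
    fun y hy => hu y (Ioo_subset_Icc_self hy)
  have := hv y hy
  rwa [h, le_div_iff₀ (sub_pos.2 hab)] at this

lemma nonneg_of_monotoneOn {u : ℝ → ℝ} {a r : ℝ} (hr : 0 < r) (hu : HasDerivAt u a r)
    (hm : MonotoneOn u (Ioi 0)) : 0 ≤ a := by
  have h := hm.derivWithin_nonneg (x := r)
  rwa [derivWithin_of_isOpen isOpen_Ioi hr, hu.deriv] at h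

/-- A solution of the reduced system with the monotonicity and the barriers that follow from its
minimality. -/
structure IsMonotoneSolution (lam ρ₀ g₀ k : ℝ) (f f₁ w w₁ : ℝ → ℝ) : Prop where
  lam_pos : 0 < lam
  ρ₀_pos : 0 < ρ₀
  g₀_pos : 0 < g₀
  k_pos : 0 < k
  sol : IsReducedSolution lam ρ₀ g₀ f f₁ w w₁
  exp_le : ∀ r, 0 < r → Real.exp (-(g₀ * ρ₀ * r)) ≤ f r
  f_le : ∀ r, 0 < r → f r ≤ 1
  le_w : ∀ r, 0 < r → ρ₀ * r ^ 3 / (r ^ 2 + k) ≤ w r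
  w_le : ∀ r, 0 < r → w r ≤ ρ₀ * r
  anti_f : AntitoneOn f (Ioi 0)
  mono_ρ : MonotoneOn (fun r => w r / r) (Ioi 0)

theorem exists_isMonotoneSolution (hlam : 0 < lam) (hρ₀ : 0 < ρ₀) (hg₀ : 0 < g₀) :
    ∃ (k : ℝ) (f f₁ w w₁ : ℝ → ℝ), IsMonotoneSolution lam ρ₀ g₀ k f f₁ w w₁ := by
  have hsq : 0 < g₀ ^ 2 * ρ₀ ^ 2 + 2 * lam * ρ₀ ^ 2 := by positivity
  have P : Params lam ρ₀ g₀ (√(g₀ ^ 2 * ρ₀ ^ 2 + 2 * lam * ρ₀ ^ 2)) :=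
    ⟨hlam, hρ₀, hg₀, Real.sqrt_pos.2 hsq, Real.sq_sqrt hsq.le⟩
  obtain ⟨f, f₁, w, w₁, hs, hz, h0, hmin⟩ := exists_minimal_solution P
  have hk : lam * ρ₀ ^ 2 * (6 / (lam * ρ₀ ^ 2)) = 6 := by field_simp
  have hbar := isUpperPair_barrier P hk
  have hscaled : ∀ a b, 0 < a → a < b → f b ≤ f a ∧ w a / a ≤ w b / b := fun a b ha hab => by
    have hb := ha.trans hab
    -- Dilation by `s = a / b`, evaluated at `b`, compares the solution at `b` with itself at `a`.
    have hs0 : 0 < a / b := by positivity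
    have hs1 : a / b < 1 := (div_lt_one hb).2 hab
    have := hmin _ _ (isUpperPair_scaled hs hz hlam hs0 hs1) (fun r hr => ⟨?_, ?_⟩) b hb
    · simp only [div_mul_cancel₀ _ hb.ne'] at this
      refine ⟨this.1, ?_⟩
      rw [le_div_iff₀ hb]
      refine le_trans (le_of_eq ?_) this.2
      field_simp
    · refine le_trans (Real.exp_le_exp.2 ?_) (h0 _ (mul_pos hs0 hr)).1
      have : a / b * r ≤ r := mul_le_of_le_one_left hr.le hs1.le
      have := mul_le_mul_of_nonneg_left this (by positivity : 0 ≤ g₀ * ρ₀)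
      linarith
    · change w (a / b * r) / (a / b) ≤ ρ₀ * r
      rw [div_le_iff₀ hs0]
      linarith [hz.w_le _ (mul_pos hs0 hr)]
  refine ⟨_, f, f₁, w, w₁, hlam, hρ₀, hg₀, by positivity, hs, fun r hr => (h0 r hr).1, hz.f_le,
    fun r hr => (hmin _ _ hbar (fun r hr => ⟨?_, ?_⟩) r hr).2, hz.w_le, fun a ha b _ hab => ?_,
    fun a ha b _ hab => ?_⟩
  · exact (isRegular_approx P 0).inRange.f_le r hr
  · exact hbar.inRange.w_le r hr
  · rcases hab.eq_or_lt with rfl | hab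
    exacts [le_rfl, (hscaled a b ha hab).1]
  · rcases hab.eq_or_lt with rfl | hab
    exacts [le_rfl, (hscaled a b ha hab).2]

namespace IsMonotoneSolution

variable {k r : ℝ} {f f₁ w w₁ : ℝ → ℝ}

lemma f_pos (h : IsMonotoneSolution lam ρ₀ g₀ k f f₁ w w₁) (hr : 0 < r) : 0 < f r :=
  (Real.exp_pos _).trans_le (h.exp_le r hr)

lemma w_pos (h : IsMonotoneSolution lam ρ₀ g₀ k f f₁ w w₁) (hr : 0 < r) : 0 < w r := by
  have := h.k_pos
  have := h.ρ₀_pos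
  exact lt_of_lt_of_le (by positivity) (h.le_w r hr)

lemma ρ_pos (h : IsMonotoneSolution lam ρ₀ g₀ k f f₁ w w₁) (hr : 0 < r) : 0 < w r / r :=
  div_pos (h.w_pos hr) hr

lemma ρ_le (h : IsMonotoneSolution lam ρ₀ g₀ k f f₁ w w₁) (hr : 0 < r) : w r / r ≤ ρ₀ :=
  (div_le_iff₀ hr).2 (h.w_le r hr)

lemma le_ρ (h : IsMonotoneSolution lam ρ₀ g₀ k f f₁ w w₁) (hr : 0 < r) :
    ρ₀ * r ^ 2 / (r ^ 2 + k) ≤ w r / r := by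
  rw [le_div_iff₀ hr]
  refine le_trans (le_of_eq ?_) (h.le_w r hr)
  ring

lemma hasDerivAt_ρ (h : IsMonotoneSolution lam ρ₀ g₀ k f f₁ w w₁) (hr : 0 < r) :
    HasDerivAt (fun r => w r / r) ((r * w₁ r - w r) / r ^ 2) r := by
  refine ((h.sol.deriv_w r hr).div (hasDerivAt_id r) hr.ne').congr_deriv ?_
  simp only [id]
  ring

/-- The flux `r w₁ - w` equals `r² ρ'`, so its sign is that of `ρ'`. -/
lemma hasDerivAt_flux (h : IsMonotoneSolution lam ρ₀ g₀ k f f₁ w w₁) (hr : 0 < r) :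
    HasDerivAt (fun r => r * w₁ r - w r)
      (r * w r * (2 * f r ^ 2 / r ^ 2 + lam * ((w r / r) ^ 2 - ρ₀ ^ 2))) r := by
  refine (((hasDerivAt_id r).mul (h.sol.deriv_w₁ r hr)).sub (h.sol.deriv_w r hr)).congr_deriv ?_
  simp only [id]
  ring

lemma f₁_nonpos (h : IsMonotoneSolution lam ρ₀ g₀ k f f₁ w w₁) (hr : 0 < r) : f₁ r ≤ 0 := by
  have := nonneg_of_monotoneOn hr (h.sol.deriv_f r hr).neg h.anti_f.neg
  linarith

lemma flux_nonneg (h : IsMonotoneSolution lam ρ₀ g₀ k f f₁ w w₁) (hr : 0 < r) :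
    0 ≤ r * w₁ r - w r := by
  have := nonneg_of_monotoneOn hr (h.hasDerivAt_ρ hr) h.mono_ρ
  rwa [le_div_iff₀ (by positivity), zero_mul] at this

/-- At a point with `f = 1`, a maximum, the equation would give `f'' = g₀² ρ² f > 0`. -/
lemma f_lt_one (h : IsMonotoneSolution lam ρ₀ g₀ k f f₁ w w₁) (hr : 0 < r) : f r < 1 := by
  refine lt_of_le_of_ne (h.f_le r hr) fun h1 => ?_
  refine not_isLocalMin_of_second_deriv_neg (u := fun y => -f y) (v := fun y => -f₁ y) (x := r) ?_
    (h.sol.deriv_f₁ r hr).fun_neg ?_ ?_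
  · filter_upwards [Ioi_mem_nhds hr] with y hy using (h.sol.deriv_f y hy).fun_neg
  · have := h.ρ_pos hr
    have := h.g₀_pos
    rw [h1, neg_lt_zero]
    norm_num
    positivity
  · filter_upwards [Ioi_mem_nhds hr] with y hy
    linarith [h.f_le y hy]

/-- At a contact point `ρ₀ r - w` has minimum zero, while its second derivative is `-2 f² w / r² <
0`. -/
lemma ρ_lt (h : IsMonotoneSolution lam ρ₀ g₀ k f f₁ w w₁) (hr : 0 < r) : w r / r < ρ₀ := by
  refine lt_of_le_of_ne (h.ρ_le hr) fun h1 => ?_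
  refine not_isLocalMin_of_second_deriv_neg (u := fun y => ρ₀ * y - w y)
    (v := fun y => ρ₀ - w₁ y) (x := r) ?_ ((h.sol.deriv_w₁ r hr).const_sub ρ₀) ?_ ?_
  · filter_upwards [Ioi_mem_nhds hr] with y hy
    have := ((hasDerivAt_id y).const_mul ρ₀).fun_sub (h.sol.deriv_w y hy)
    simpa using this
  · have := h.w_pos hr
    have := h.f_pos hr
    rw [h1, neg_lt_zero, sub_self, mul_zero, add_zero]
    positivity
  · filter_upwards [Ioi_mem_nhds hr] with y hy
    have : w r = ρ₀ * r := by rw [← h1]; field_simp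
    linarith [h.w_le y hy]

/-- A zero of `f₁ ≤ 0` is a maximum of `f₁`. But there `f''' > 0`: with `f' = 0`, the term `(f² - 1)
/ r²` increases strictly and `ρ²` does not decrease. -/
lemma f₁_neg (h : IsMonotoneSolution lam ρ₀ g₀ k f f₁ w w₁) (hr : 0 < r) : f₁ r < 0 := by
  refine lt_of_le_of_ne (h.f₁_nonpos hr) fun h1 => ?_
  have hfr := h.f_pos hr
  have hmin : IsLocalMin (fun y => -f₁ y) r := by
    filter_upwards [Ioi_mem_nhds hr] with y hy
    linarith [h.f₁_nonpos hy]
  have hQ := hmin.hasDerivAt_eq_zero (h.sol.deriv_f₁ r hr).fun_neg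
  rw [neg_eq_zero, mul_eq_zero, or_iff_right hfr.ne'] at hQ
  have hd := (h.sol.deriv_f r hr).mul ((((((h.sol.deriv_f r hr).pow 2).sub_const 1).div
    ((hasDerivAt_id r).pow 2) (pow_ne_zero 2 hr.ne'))).add
    (((h.hasDerivAt_ρ hr).pow 2).const_mul (g₀ ^ 2)))
  refine not_isLocalMin_of_second_deriv_neg ?_ hd.neg ?_ hmin
  · filter_upwards [Ioi_mem_nhds hr] with y hy using (h.sol.deriv_f₁ y hy).fun_neg
  · have e : f₁ r * ((f r ^ 2 - 1) / r ^ 2 + g₀ ^ 2 * (w r / r) ^ 2) + f r *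
        ((2 * f r * f₁ r * r ^ 2 - (f r ^ 2 - 1) * (2 * r)) / (r ^ 2) ^ 2 +
          g₀ ^ 2 * (2 * (w r / r) * ((r * w₁ r - w r) / r ^ 2))) =
        f r * (2 * (1 - f r ^ 2) / r ^ 3 +
          g₀ ^ 2 * (2 * (w r / r) * ((r * w₁ r - w r) / r ^ 2))) := by
      rw [h1]
      field_simp
      ring
    have hpos : 0 < f r * (2 * (1 - f r ^ 2) / r ^ 3 +
        g₀ ^ 2 * (2 * (w r / r) * ((r * w₁ r - w r) / r ^ 2))) := by
      have := h.f_lt_one hr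
      have : 0 < 1 - f r ^ 2 := by nlinarith
      have := h.ρ_pos hr
      have := h.flux_nonneg hr
      positivity
    rw [← e] at hpos
    refine neg_lt_zero.2 ?_
    simpa using hpos

/-- A zero of the nonnegative flux is a minimum, so the bracket in its derivative vanishes there. As
`ρ' = 0` and `f² / r²` strictly decreases, the second derivative of the flux is negative. -/
lemma flux_pos (h : IsMonotoneSolution lam ρ₀ g₀ k f f₁ w w₁) (hr : 0 < r) :
    0 < r * w₁ r - w r := by
  refine lt_of_le_of_ne (h.flux_nonneg hr) fun h1 => ?_
  have hwr := h.w_pos hr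
  have hmin : IsLocalMin (fun r => r * w₁ r - w r) r := by
    filter_upwards [Ioi_mem_nhds hr] with y hy
    rw [← h1]
    exact h.flux_nonneg hy
  have hQ := hmin.hasDerivAt_eq_zero (h.hasDerivAt_flux hr)
  rw [mul_eq_zero, or_iff_right (by positivity)] at hQ
  have hd := ((hasDerivAt_id r).mul (h.sol.deriv_w r hr)).mul
    (((((h.sol.deriv_f r hr).pow 2).const_mul 2).div
    ((hasDerivAt_id r).pow 2) (pow_ne_zero 2 hr.ne')).add
    ((((h.hasDerivAt_ρ hr).pow 2).sub_const (ρ₀ ^ 2)).const_mul lam))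
  refine not_isLocalMin_of_second_deriv_neg ?_ hd ?_ hmin
  · filter_upwards [Ioi_mem_nhds hr] with y hy using h.hasDerivAt_flux hy
  · have hfr := h.f_pos hr
    have hneg : r * w r * ((4 * f r * f₁ r * r - 4 * f r ^ 2) / r ^ 3) < 0 := by
      refine mul_neg_of_pos_of_neg (by positivity) (div_neg_of_neg_of_pos ?_ (by positivity))
      have : 4 * f r * f₁ r * r ≤ 0 :=
        mul_nonpos_of_nonpos_of_nonneg (mul_nonpos_of_nonneg_of_nonpos (by positivity)
          (h.f₁_nonpos hr)) hr.le
      have : 0 < 4 * f r ^ 2 := by positivity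
      linarith
    refine lt_of_eq_of_lt ?_ hneg
    simp only [Pi.mul_apply, Pi.add_apply, Pi.div_apply, Pi.pow_apply, id, hQ, ← h1]
    field_simp
    push_cast
    ring

/-! ### Limits at infinity and at the origin. -/

lemma tendsto_f (h : IsMonotoneSolution lam ρ₀ g₀ k f f₁ w w₁) : Tendsto f atTop (𝓝 0) := by
  have hk := h.k_pos
  have hm : 0 < g₀ * ρ₀ := mul_pos h.g₀_pos h.ρ₀_pos
  have key : ∀ ε > 0, ∃ R > 0, f R < ε := by
    intro ε hε
    by_contra! hcon
    -- Beyond `R`, `r² ≥ k` gives `ρ ≥ ρ₀ / 2`, hence `g₀² ρ² ≥ 2 c`, and `1 / r² ≤ c` costs one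
    -- `c`. So `f'' ≥ ε c`, and `b` is chosen so that `f₁ b ≥ 1`, contradicting `f₁ ≤ 0`.
    set c := (g₀ * ρ₀) ^ 2 / 8 with hc
    have hc0 : 0 < c := by positivity
    set R := 1 + k + 1 / c with hR
    have hR0 : 0 < R := by positivity
    set b := R + (1 - f₁ R) / (ε * c) with hb
    have hfR := h.f₁_nonpos hR0
    have hRb : R < b := by
      have : 0 < (1 - f₁ R) / (ε * c) := div_pos (by linarith) (by positivity)
      linarith
    have h1 := mul_sub_le_of_le_deriv (c := ε * c) hRb
      (fun y hy => h.sol.deriv_f₁ y (hR0.trans_le hy.1)) fun y hy => ?_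
    · have : ε * c * (b - R) = 1 - f₁ R := by rw [hb]; field_simp; ring
      have := h.f₁_nonpos (hR0.trans hRb)
      linarith
    · have hy0 : 0 < y := hR0.trans hy.1
      have hRy := hy.1
      have hc1 : 0 < 1 / c := by positivity
      have hy2 : y ≤ y ^ 2 := by nlinarith
      have hρ : ρ₀ / 2 ≤ w y / y := by
        refine le_trans ?_ (h.le_ρ hy0)
        rw [div_le_div_iff₀ two_pos (by positivity)]
        nlinarith [h.ρ₀_pos]
      have hρ2 : (ρ₀ / 2) ^ 2 ≤ (w y / y) ^ 2 :=
        pow_le_pow_left₀ (by linarith [h.ρ₀_pos]) hρ 2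
      have hf2 : -c ≤ (f y ^ 2 - 1) / y ^ 2 := by
        rw [le_div_iff₀ (by positivity)]
        have : 1 ≤ c * y ^ 2 := by
          have : 1 / c ≤ y ^ 2 := by linarith
          rwa [div_le_iff₀' hc0] at this
        nlinarith [sq_nonneg (f y)]
      have hQ : c ≤ (f y ^ 2 - 1) / y ^ 2 + g₀ ^ 2 * (w y / y) ^ 2 := by
        have := mul_le_mul_of_nonneg_left hρ2 (sq_nonneg g₀)
        have : g₀ ^ 2 * (ρ₀ / 2) ^ 2 = 2 * c := by rw [hc]; ring
        linarith
      exact mul_le_mul (hcon y hy0) hQ hc0.le (h.f_pos hy0).le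
  rw [Metric.tendsto_atTop]
  intro ε hε
  obtain ⟨R, hR, hfR⟩ := key ε hε
  refine ⟨R, fun r hr => ?_⟩
  have hr0 := hR.trans_le hr
  rw [Real.dist_eq, sub_zero, abs_of_pos (h.f_pos hr0)]
  exact (h.anti_f hR hr0 hr).trans_lt hfR

lemma tendsto_ρ_atTop (h : IsMonotoneSolution lam ρ₀ g₀ k f f₁ w w₁) :
    Tendsto (fun r => w r / r) atTop (𝓝 ρ₀) := by
  have hk := h.k_pos
  have hlow : Tendsto (fun r : ℝ => ρ₀ - ρ₀ * k * (r⁻¹ * r⁻¹)) atTop (𝓝 ρ₀) := by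
    have := (((tendsto_inv_atTop_zero (𝕜 := ℝ)).mul tendsto_inv_atTop_zero).const_mul
      (ρ₀ * k)).const_sub ρ₀
    simpa using this
  refine tendsto_of_tendsto_of_tendsto_of_le_of_le' hlow tendsto_const_nhds ?_ ?_ <;>
    filter_upwards [eventually_gt_atTop 0] with r hr
  · refine le_trans ?_ (h.le_ρ hr)
    rw [le_div_iff₀ (by positivity)]
    have e : (ρ₀ - ρ₀ * k * (r⁻¹ * r⁻¹)) * (r ^ 2 + k) = ρ₀ * r ^ 2 - ρ₀ * k ^ 2 * (r⁻¹ * r⁻¹) := by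
      field_simp
      ring
    have := h.ρ₀_pos
    have : 0 ≤ ρ₀ * k ^ 2 * (r⁻¹ * r⁻¹) := by positivity
    linarith
  · exact h.ρ_le hr

lemma tendsto_f_zero (h : IsMonotoneSolution lam ρ₀ g₀ k f f₁ w w₁) :
    Tendsto f (𝓝[>] 0) (𝓝 1) := by
  have hc : Continuous fun r : ℝ => Real.exp (-(g₀ * ρ₀ * r)) := by fun_prop
  have hlow := (hc.tendsto 0).mono_left (nhdsWithin_le_nhds (s := Ioi 0))
  simp only [mul_zero, neg_zero, Real.exp_zero] at hlow
  refine tendsto_of_tendsto_of_tendsto_of_le_of_le' hlow tendsto_const_nhds ?_ ?_ <;>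
    filter_upwards [self_mem_nhdsWithin] with r hr
  exacts [h.exp_le r hr, h.f_le r hr]

/-- If `ρ ≥ ε` throughout, the flux has slope at least `ε` near `0`, so `ρ' ≥ ε / (2 r)`;
integrating gives a logarithm, incompatible with `0 < ρ ≤ ρ₀`. -/
lemma tendsto_ρ_zero (h : IsMonotoneSolution lam ρ₀ g₀ k f f₁ w w₁) :
    Tendsto (fun r => w r / r) (𝓝[>] 0) (𝓝 0) := by
  have key : ∀ ε > 0, ∃ δ > 0, w δ / δ < ε := by
    intro ε hε
    by_contra! hcon
    have hlim : Tendsto (fun r => 2 * f r ^ 2 - lam * ρ₀ ^ 2 * r ^ 2) (𝓝[>] 0) (𝓝 2) := by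
      have hc : Continuous fun r : ℝ => lam * ρ₀ ^ 2 * r ^ 2 := by fun_prop
      have := ((h.tendsto_f_zero.pow 2).const_mul 2).sub
        ((hc.tendsto 0).mono_left (nhdsWithin_le_nhds (s := Ioi 0)))
      simpa using this
    obtain ⟨δ, hδ, hδ1⟩ := mem_nhdsGT_iff_exists_Ioo_subset.1
      (hlim.eventually (lt_mem_nhds one_lt_two))
    have hδ0 : 0 < δ := hδ
    have hflux : ∀ y, 0 < y → y < δ → ε / 2 / y ≤ (y * w₁ y - w y) / y ^ 2 := fun y hy hyδ => by
      -- On `[y / 2, y]` the flux starts nonnegative and gains at least `ε y / 2`.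
      have h1 := mul_sub_le_of_le_deriv (c := ε) (half_lt_self hy)
        (fun x hx => h.hasDerivAt_flux ((half_pos hy).trans_le hx.1)) fun x hx => ?_
      · have := h.flux_nonneg (half_pos hy)
        rw [div_div, div_le_div_iff₀ (by positivity) (by positivity)]
        nlinarith
      · have hx0 := (half_pos hy).trans hx.1
        have h2 : 1 < 2 * f x ^ 2 - lam * ρ₀ ^ 2 * x ^ 2 := hδ1 ⟨hx0, hx.2.trans hyδ⟩
        have h3 := hcon x hx0
        have e : x * w x * (2 * f x ^ 2 / x ^ 2 + lam * ((w x / x) ^ 2 - ρ₀ ^ 2)) =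
            w x / x * (2 * f x ^ 2 - lam * ρ₀ ^ 2 * x ^ 2 + lam * (w x) ^ 2) := by
          field_simp
          ring
        have := h.lam_pos
        have h4 : 0 ≤ lam * (w x) ^ 2 := by positivity
        rw [e]
        nlinarith
    have hlog : ∀ s, 0 < s → s < δ / 2 → ε / 2 * (Real.log (δ / 2) - Real.log s) ≤ ρ₀ :=
      fun s hs hsδ => by
      have h1 := mul_sub_le_of_le_deriv (c := 0) hsδ
        (u := fun y => w y / y - ε / 2 * Real.log y)
        (fun x hx => (h.hasDerivAt_ρ (hs.trans_le hx.1)).fun_sub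
          ((Real.hasDerivAt_log (hs.trans_le hx.1).ne').const_mul (ε / 2))) fun x hx => ?_
      · have := h.ρ_le (half_pos hδ0)
        have := h.ρ_pos hs
        linarith
      · have := hflux x (hs.trans hx.1) (hx.2.trans (half_lt_self hδ0))
        rw [sub_nonneg, ← div_eq_mul_inv]
        exact this
    have hev := (Real.tendsto_log_nhdsGT_zero.eventually
      (eventually_lt_atBot (Real.log (δ / 2) - 2 * ρ₀ / ε))).and
      (Ioo_mem_nhdsGT (half_pos hδ0))
    obtain ⟨s, hs1, hs2⟩ := hev.exists
    have h1 := hlog s hs2.1 hs2.2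
    have h2 : ε / 2 * (2 * ρ₀ / ε) = ρ₀ := by field_simp
    nlinarith
  rw [Metric.tendsto_nhdsWithin_nhds]
  intro ε hε
  obtain ⟨δ, hδ, hfδ⟩ := key ε hε
  refine ⟨δ, hδ, fun {r} hr hd => ?_⟩
  have hr0 : 0 < r := hr
  rw [Real.dist_eq, sub_zero, abs_of_pos hr0] at hd
  rw [Real.dist_eq, sub_zero, abs_of_pos (h.ρ_pos hr0)]
  exact (h.mono_ρ hr hδ hd.le).trans_lt hfδ

end IsMonotoneSolution

/-! ### Return to the original formulation. -/

lemma contDiffOn_two_of_hasDerivAt {u u₁ u₂ : ℝ → ℝ} (hu : ∀ r, 0 < r → HasDerivAt u (u₁ r) r)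
    (hu₁ : ∀ r, 0 < r → HasDerivAt u₁ (u₂ r) r) (hu₂ : ContinuousOn u₂ (Ioi 0)) :
    ContDiffOn ℝ 2 u (Ioi 0) := by
  have step : ∀ {v v₁ : ℝ → ℝ} {n : ℕ}, (∀ r, 0 < r → HasDerivAt v (v₁ r) r) →
      ContDiffOn ℝ n v₁ (Ioi 0) → ContDiffOn ℝ (n + 1) v (Ioi 0) := fun hv hv₁ =>
    (contDiffOn_succ_iff_deriv_of_isOpen isOpen_Ioi).2
      ⟨fun r hr => (hv r hr).differentiableAt.differentiableWithinAt, by simp,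
        hv₁.congr fun r hr => (hv r hr).deriv⟩
  have h0 : ContDiffOn ℝ (0 : ℕ) u₂ (Ioi 0) := contDiffOn_zero.2 hu₂
  have h1 : ContDiffOn ℝ ((0 : ℕ) + 1) u₁ (Ioi 0) := step hu₁ h0
  have h2 := step (n := 1) hu (by simpa using h1)
  exact_mod_cast h2

lemma deriv_deriv_of_hasDerivAt {u u₁ u₂ : ℝ → ℝ} {r : ℝ}
    (hu : ∀ r, 0 < r → HasDerivAt u (u₁ r) r) (hu₁ : ∀ r, 0 < r → HasDerivAt u₁ (u₂ r) r)
    (hr : 0 < r) : deriv (deriv u) r = u₂ r := by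
  have : deriv u =ᶠ[𝓝 r] u₁ := by
    filter_upwards [Ioi_mem_nhds hr] with y hy using (hu y hy).deriv
  rw [this.deriv_eq, (hu₁ r hr).deriv]

end Monopole

open Monopole

theorem theorem1 (lam ρ₀ g₀ : ℝ) (hlam : 0 < lam) (hρ₀ : 0 < ρ₀) (hg₀ : 0 < g₀) :
    ∃ f ρ : ℝ → ℝ,
      IsMonopoleSolution lam ρ₀ g₀ f ρ ∧
      MonopoleBoundaryConditions ρ₀ f ρ ∧
      ∀ r : ℝ, 0 < r →
        (0 < f r ∧ f r < 1) ∧ (0 < ρ r ∧ ρ r < ρ₀) ∧ deriv f r < 0 ∧ 0 < deriv ρ r := by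
  obtain ⟨k, f, f₁, w, w₁, h⟩ := exists_isMonotoneSolution hlam hρ₀ hg₀
  -- The construction controls `f` only on `(0, ∞)`, so its value at `0` is set by hand; `w r / r`
  -- is already `0` at `0` because division by zero gives zero.
  set F := Function.update f 0 1 with hF
  have Feq : ∀ r, 0 < r → F r = f r := fun r hr => Function.update_of_ne hr.ne' _ _
  have Fd : ∀ r, 0 < r → HasDerivAt F (f₁ r) r := fun r hr => by
    refine (h.sol.deriv_f r hr).congr_of_eventuallyEq ?_
    filter_upwards [Ioi_mem_nhds hr] using Feq
  have cf : ContinuousOn f (Ioi 0) := fun r hr => (h.sol.deriv_f r hr).continuousAt.continuousWithinAt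
  have cw : ContinuousOn w (Ioi 0) := fun r hr => (h.sol.deriv_w r hr).continuousAt.continuousWithinAt
  have cw₁ : ContinuousOn w₁ (Ioi 0) :=
    fun r hr => (h.sol.deriv_w₁ r hr).continuousAt.continuousWithinAt
  have hne : ∀ x ∈ Ioi (0 : ℝ), x ≠ 0 := fun x hx => ne_of_gt hx
  have hρ₁ : ∀ r, 0 < r → HasDerivAt (fun r => (r * w₁ r - w r) / r ^ 2)
      ((r * w r * (2 * f r ^ 2 / r ^ 2 + lam * ((w r / r) ^ 2 - ρ₀ ^ 2)) * r ^ 2 -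
        (r * w₁ r - w r) * (2 * r)) / (r ^ 2) ^ 2) r := fun r hr => by
    refine ((h.hasDerivAt_flux hr).div ((hasDerivAt_id r).pow 2)
      (pow_ne_zero 2 hr.ne')).congr_deriv ?_
    simp
  refine ⟨F, fun r => w r / r, ⟨?_, ?_, fun r hr => ?_, fun r hr => ?_⟩,
    ⟨Function.update_self _ _ _, ?_, div_zero _, ?_, ?_, h.tendsto_ρ_atTop⟩, fun r hr => ?_⟩
  · refine contDiffOn_two_of_hasDerivAt Fd h.sol.deriv_f₁ ?_
    have hsq : ∀ x ∈ Ioi (0 : ℝ), x ^ 2 ≠ 0 := fun x hx => pow_ne_zero 2 (hne x hx)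
    fun_prop (disch := assumption)
  · refine contDiffOn_two_of_hasDerivAt (fun r hr => h.hasDerivAt_ρ hr) hρ₁ ?_
    have hsq : ∀ x ∈ Ioi (0 : ℝ), x ^ 2 ≠ 0 := fun x hx => pow_ne_zero 2 (hne x hx)
    have hsq' : ∀ x ∈ Ioi (0 : ℝ), (x ^ 2) ^ 2 ≠ 0 := fun x hx => pow_ne_zero 2 (hsq x hx)
    fun_prop (disch := assumption)
  · rw [deriv_deriv_of_hasDerivAt Fd h.sol.deriv_f₁ hr, Feq r hr]
    ring
  · rw [deriv_deriv_of_hasDerivAt (fun r hr => h.hasDerivAt_ρ hr) hρ₁ hr,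
      (h.hasDerivAt_ρ hr).deriv, Feq r hr]
    field_simp
    ring
  · rw [← continuousWithinAt_Ioi_iff_Ici, ContinuousWithinAt, hF, Function.update_self]
    refine h.tendsto_f_zero.congr' ?_
    filter_upwards [self_mem_nhdsWithin] with r hr using (Feq r hr).symm
  · rw [← continuousWithinAt_Ioi_iff_Ici, ContinuousWithinAt, div_zero]
    exact h.tendsto_ρ_zero
  · refine h.tendsto_f.congr' ?_
    filter_upwards [eventually_gt_atTop 0] with r hr using (Feq r hr).symm
  · rw [(Fd r hr).deriv, (h.hasDerivAt_ρ hr).deriv, Feq r hr]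
    exact ⟨⟨h.f_pos hr, h.f_lt_one hr⟩, ⟨h.ρ_pos hr, h.ρ_lt hr⟩, h.f₁_neg hr,
      div_pos (h.flux_pos hr) (by positivity)⟩
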